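/- Let $G$ be a group, let $A,B$ be sets with chosen elements $a_0\in A$, $b_0\in B$, and let $C\colon B\times A\to G$ be a matrix that is normalized with respect to $a_0,b_0$, i.e. $C_{b_0a}=1=C_{ba_0}$ for all $a\in A$, $b\in B$. Let $S=\mathcal M(G,A,B,C)$ be the Rees matrix semigroup, that is, the set $A\times G\times B$ with multiplication $(a,g,b)(a',g',b')=(a,gC_{ba'}g',b')$, let $M=S^1$ be the monoid obtained from $S$ by adjoining a (new) identity, and put $\overline A=A\setminus\{a_0\}$. A left module over a ring is of type $\mathrm{FP}_n$ if it has a projective resolution that is finitely generated in degrees $0,\dots,n$; a monoid $M$ is of type $\mathrm{FP}_n$ if the trivial left $\mathbb ZM$-module $\mathbb Z$ is. For a subset $Y\subseteq G$, let $F_Y$ be the free group on the disjoint union of $Y$ and the set of formal symbols $\{C_{ba}\mid a\in\overline A,\ b\in B\}$ (one symbol for each pair $(a,b)$, even if some entries coincide in $G$), let $\gamma_Y\colon F_Y\to G$ be the natural homomorphism and $R_Y=\ker\gamma_Y$. If $\gamma_Y$ is onto, conjugation in $F_Y$ makes the abelianization $R_Y^{\mathrm{ab}}$ a left $\mathbb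 ZG$-module, the relation module. Let $n\ge 1$. Then $M$ is of type $\mathrm{FP}_n$ if and only if $A$ is finite and there is a finite subset $Y\subseteq G$ such that $\gamma_Y$ is onto and, if $n\ge 2$, the relation module $R_Y^{\mathrm{ab}}$ is of type $\mathrm{FP}_{n-2}$ over $\mathbb ZG$. Moreover, the latter condition is independent of the choice of $Y$: if $n\geq 2$ and $Y,Y'\subseteq G$ are finite with $\gamma_Y$ and $\gamma_{Y'}$ onto, then $R_Y^{\mathrm{ab}}$ is of type $\mathrm{FP}_{n-2}$ if and only if $R_{Y'}^{\mathrm{ab}}$ is. -/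

import Mathlib

universe u v w

/-- A left module `N` over a ring `R` is of type `FP_n` if it has a projective resolution
`⋯ → P 1 → P 0 → N → 0` in which `P i` is finitely generated for all `i ≤ n`. -/
def ModuleIsFP (R : Type u) [Ring R] (N : Type v) [AddCommGroup N] [Module R N] (n : ℕ) : Prop :=
  ∃ (P : ℕ → ModuleCat.{max u v} R) (d : ∀ i, P (i + 1) →ₗ[R] P i) (ε : P 0 →ₗ[R] N),
    Function.Surjective ε ∧
    Function.Exact (d 0) ε ∧
    (∀ i, Function.Exact (d (i + 1)) (d i)) ∧
    (∀ i, Module.Projective R (P i)) ∧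
    (∀ i, i ≤ n → Module.Finite R (P i))

/-- A monoid `M` is of type (left) `FP_n` if the trivial left `ℤM`-module `ℤ` is of type `FP_n`. -/
def MonoidIsFP (M : Type u) [Monoid M] (n : ℕ) : Prop :=
  ModuleIsFP (MonoidAlgebra ℤ M) (Representation.trivial ℤ M ℤ).asModule n

/-- The underlying set `A × G × B` of the Rees matrix semigroup with sandwich matrix
`C : B × A → G`. -/
@[ext]
structure ReesMatrix {G : Type u} {A : Type v} {B : Type w} (C : B → A → G) where
  row : A
  val : G
  col : B

namespace ReesMatrix

variable {G : Type u} [Group G] {A : Type v} {B : Type w} {C : B → A → G}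

/-- The multiplication `(a, g, b) (a', g', b') = (a, g C_{b a'} g', b')`. -/
instance : Semigroup (ReesMatrix C) where
  mul s t := ⟨s.row, s.val * C s.col t.row * t.val, t.col⟩
  mul_assoc s t r := by
    change (ReesMatrix.mk _ _ _ : ReesMatrix C) = ReesMatrix.mk _ _ _
    congr 1
    change s.val * C s.col t.row * t.val * C t.col r.row * r.val =
      s.val * C s.col t.row * (t.val * C t.col r.row * r.val)
    simp only [mul_assoc]

theorem mul_def (s t : ReesMatrix C) :
    s * t = ⟨s.row, s.val * C s.col t.row * t.val, t.col⟩ := rfl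

/-- The matrix `C` is normalized with respect to `a₀` and `b₀`. -/
def IsNormalized (C : B → A → G) (a₀ : A) (b₀ : B) : Prop :=
  (∀ a, C b₀ a = 1) ∧ (∀ b, C b a₀ = 1)

/-- The natural map to `G` from the free group on the generators `y ∈ Y` together with one
generator for each matrix entry `C_{ba}` with `a ≠ a₀` (entries at different positions give
different generators, even if they are equal as elements of `G`). -/
def naturalMap (C : B → A → G) (a₀ : A) (Y : Set G) :
    FreeGroup (Y ⊕ ({a : A // a ≠ a₀} × B)) →* G :=
  FreeGroup.lift (Sum.elim (fun y => (y : G)) (fun p => C p.2 p.1))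

end ReesMatrix

namespace RelationModule

variable {F : Type u} {H : Type v} [Group F] [Group H] (ψ : F →* H)

/-- The conjugation action of `F` on the abelianization of `R = ker ψ`. -/
def conjRep : Representation ℤ F (Additive (Abelianization ψ.ker)) where
  toFun f := (MonoidHom.toAdditive
    (Abelianization.map (MulAut.conjNormal f : MulAut ψ.ker).toMonoidHom)).toIntLinearMap
  map_one' := by
    ext x
    obtain ⟨r, rfl⟩ := QuotientGroup.mk_surjective (Additive.toMul x)
    change Abelianization.of ((MulAut.conjNormal (1 : F) : MulAut ψ.ker) r) = Abelianization.of r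
    simp
  map_mul' f g := by
    ext x
    obtain ⟨r, rfl⟩ := QuotientGroup.mk_surjective (Additive.toMul x)
    change Abelianization.of ((MulAut.conjNormal (f * g) : MulAut ψ.ker) r) =
      Abelianization.of ((MulAut.conjNormal f : MulAut ψ.ker)
        ((MulAut.conjNormal g : MulAut ψ.ker) r))
    simp

theorem conjRep_of (f : F) (r : ψ.ker) :
    conjRep ψ f (Additive.ofMul (Abelianization.of r)) =
      Additive.ofMul (Abelianization.of (MulAut.conjNormal f r)) := rfl

theorem conjRep_ker (f : F) (hf : f ∈ ψ.ker) : conjRep ψ f = 1 := by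
  ext x
  obtain ⟨r, rfl⟩ := QuotientGroup.mk_surjective (Additive.toMul x)
  change Abelianization.of ((MulAut.conjNormal f : MulAut ψ.ker) r) = Abelianization.of r
  have h : (MulAut.conjNormal f : MulAut ψ.ker) r = ⟨f, hf⟩ * r * ⟨f, hf⟩⁻¹ := by
    ext
    simp
  rw [h, map_mul, map_mul, map_inv, mul_comm, inv_mul_cancel_left]

/-- The action of `H` on the abelianization of `R = ker ψ` induced by conjugation, for a
surjective homomorphism `ψ : F → H`. -/
noncomputable def rep (hψ : Function.Surjective ψ) :
    Representation ℤ H (Additive (Abelianization ψ.ker)) :=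
  (QuotientGroup.lift ψ.ker (conjRep ψ) (conjRep_ker ψ)).comp
    (QuotientGroup.quotientKerEquivOfSurjective ψ hψ).symm.toMonoidHom

theorem rep_apply (hψ : Function.Surjective ψ) (f : F) : rep ψ hψ (ψ f) = conjRep ψ f := by
  have h : (QuotientGroup.quotientKerEquivOfSurjective ψ hψ).symm (ψ f) =
      (QuotientGroup.mk f : F ⧸ ψ.ker) := by
    rw [MulEquiv.symm_apply_eq]
    rfl
  change QuotientGroup.lift ψ.ker (conjRep ψ) (conjRep_ker ψ)
    ((QuotientGroup.quotientKerEquivOfSurjective ψ hψ).symm (ψ f)) = _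
  rw [h]
  rfl

end RelationModule

/-- The relation module of a surjective homomorphism `ψ : F → H` (the abelianization of
`R = ker ψ`, with the `ℤH`-module structure induced by conjugation) is of type `FP_n`. -/
def RelationModuleIsFP {F : Type u} {H : Type v} [Group F] [Group H] (ψ : F →* H)
    (hψ : Function.Surjective ψ) (n : ℕ) : Prop :=
  ModuleIsFP (MonoidAlgebra ℤ H) (RelationModule.rep ψ hψ).asModule n

-- Let e = (a₀, 1, b₀). Since C is normalized, e is idempotent, so the left ideal ℤMe is a
-- projective ℤM-module; as a right ℤG-module it is free with basis indexed by A. Induction N ↦ ℤMe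
-- ⊗ N over ℤG, realised as `Ind C N`, is therefore exact and takes finitely generated free modules
-- to finitely generated projective ones. It also reflects finite generation, so dimension shifting
-- (`moduleIsFP_succ_iff`) shows that N and `Ind C N` are of the same finiteness type
-- (`Ind.moduleIsFP_iff`).
--
-- Let K be the kernel of the augmentation `Ind.aug` from the induced module of ℤG onto ℤ. Type FP_n
-- for M amounts to type FP_{n-1} for K (`monoidIsFP_succ_iff`). If K is finitely generated, then A
-- is finite, because elements of S annihilate the componentwise augmentation on K; and the group
-- elements occurring in the generators, together with the matrix entries, generate G.
--
-- Conversely, K is covered by one copy of ℤM for each a ≠ a₀ and by the module induced from ℤG^Y. A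
-- relation cannot involve the identity of M. What then remains of each ℤM is ℤS, which is induced
-- from the free ℤG-module on B; on this part the cover is induced from the Fox boundary map ℤG^(X)
-- → ℤG, where X is the basis of F_Y. Fox calculus identifies the kernel of that map with the
-- relation module (`relationModuleEquiv`), so the relations of K form the module induced from the
-- relation module (`Ind.exact_presentation`).
--
-- Independence of Y is a Schanuel argument over ℤG (`moduleIsFP_ker_coprod_congr`).

universe x

/-! ### Type FP_n, dimension shifting and independence of the universe. -/

section Resolutions

open LinearMap

variable {R : Type u} [Ring R]

theorem exact_comp_of_surjective {X Y Z W : Type*} [AddCommGroup X] [Module R X]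
    [AddCommGroup Y] [Module R Y] [AddCommGroup Z] [Module R Z] [AddCommGroup W] [Module R W]
    {j : X →ₗ[R] Y} {p : Y →ₗ[R] Z} {q : W →ₗ[R] X} (h : Function.Exact j p)
    (hq : Function.Surjective q) : Function.Exact (j ∘ₗ q) p := by
  intro y
  rw [h y, LinearMap.coe_comp, hq.range_comp]

theorem exact_comp_of_injective {X Y Z W : Type*} [AddCommGroup X] [Module R X]
    [AddCommGroup Y] [Module R Y] [AddCommGroup Z] [Module R Z] [AddCommGroup W] [Module R W]
    {j : X →ₗ[R] Y} {p : Y →ₗ[R] Z} {q : Z →ₗ[R] W} (h : Function.Exact j p)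
    (hq : Function.Injective q) : Function.Exact j (q ∘ₗ p) := by
  intro y
  rw [← h y, LinearMap.comp_apply, map_eq_zero_iff q hq]

/-- `N` has a projective resolution whose first `n` terms are finitely generated. -/
def HasResolution (R : Type u) [Ring R] (N : Type v) [AddCommGroup N] [Module R N] (n : ℕ) :
    Prop :=
  ∃ (P : ℕ → ModuleCat.{max u v} R) (d : ∀ i, P (i + 1) →ₗ[R] P i) (ε : P 0 →ₗ[R] N),
    Function.Surjective ε ∧
    Function.Exact (d 0) ε ∧
    (∀ i, Function.Exact (d (i + 1)) (d i)) ∧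
    (∀ i, Module.Projective R (P i)) ∧
    (∀ i, i < n → Module.Finite R (P i))

/-- With this shifted index, 0 imposes no finiteness at all, so the dimension shift also covers a
finitely generated module with an arbitrary kernel. -/
theorem moduleIsFP_iff_hasResolution {N : Type v} [AddCommGroup N] [Module R N] {n : ℕ} :
    ModuleIsFP R N n ↔ HasResolution R N (n + 1) := by
  simp only [ModuleIsFP, HasResolution, Nat.lt_succ_iff]

theorem HasResolution.of_same_universe {N : Type v} {N' : Type (max u v)} [AddCommGroup N]
    [Module R N] [AddCommGroup N'] [Module R N'] (e : N ≃ₗ[R] N') {n : ℕ} :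
    HasResolution R N n ↔ HasResolution R N' n := by
  constructor
  · rintro ⟨P, d, ε, hε, h0, hd, hP, hf⟩
    refine ⟨P, d, e.toLinearMap ∘ₗ ε, e.surjective.comp hε, fun x => ?_, hd, hP, hf⟩
    simpa using h0 x
  · rintro ⟨P, d, ε, hε, h0, hd, hP, hf⟩
    refine ⟨P, d, e.symm.toLinearMap ∘ₗ ε, e.symm.surjective.comp hε, fun x => ?_, hd, hP, hf⟩
    simpa using h0 x

/-- The terms of the canonical sequence of syzygies of a module. -/
noncomputable def syzygy (X : ModuleCat.{max u v} R) : ℕ → ModuleCat.{max u v} R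
  | 0 => X
  | i + 1 => ModuleCat.of R
      (ker (Finsupp.linearCombination R (id : syzygy X i → syzygy X i)))

/-- Each syzygy is covered by the free module on its own underlying set; splicing the covers gives a
free resolution. -/
theorem hasResolution_zero (N : Type (max u v)) [AddCommGroup N] [Module R N] :
    HasResolution R N 0 := by
  let K : ℕ → ModuleCat.{max u v} R := syzygy (ModuleCat.of R N)
  let p (i : ℕ) : (K i →₀ R) →ₗ[R] K i := Finsupp.linearCombination R id
  have hp (i : ℕ) : Function.Surjective (p i) := fun x => ⟨Finsupp.single x 1, by simp [p]⟩
  let j (i : ℕ) : K (i + 1) →ₗ[R] (K i →₀ R) := (ker (p i)).subtype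
  have hj (i : ℕ) : Function.Injective (j i) := Subtype.val_injective
  have hex (i : ℕ) : Function.Exact (j i) (p i) := (p i).exact_subtype_ker_map
  refine ⟨fun i => ModuleCat.of R (K i →₀ R), fun i => j i ∘ₗ p (i + 1), p 0, hp 0, ?_, ?_,
    fun i => inferInstanceAs (Module.Projective R (K i →₀ R)), by simp⟩
  · exact exact_comp_of_surjective (hex 0) (hp 1)
  · intro i
    exact exact_comp_of_injective (exact_comp_of_surjective (hex (i + 1)) (hp (i + 2))) (hj i)

/-- The sequence `a, f 0, f 1, …`. -/
def prependTerm {α : Type*} (a : α) (f : ℕ → α) : ℕ → α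
  | 0 => a
  | k + 1 => f k

theorem HasResolution.splice {N : Type v} {P Z : Type (max u v)} [AddCommGroup N] [Module R N]
    [AddCommGroup P] [Module R P] [AddCommGroup Z] [Module R Z]
    [Module.Finite R P] [Module.Projective R P] {i : Z →ₗ[R] P} {f : P →ₗ[R] N}
    (hi : Function.Injective i) (hf : Function.Surjective f) (hif : Function.Exact i f) {n : ℕ}
    (h : HasResolution R Z n) : HasResolution R N (n + 1) := by
  obtain ⟨Q, d, ε, hε, h0, hd, hQ, hfin⟩ := h
  let Q' : ℕ → ModuleCat.{max u v} R := prependTerm (ModuleCat.of R P) Q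
  let d' : ∀ k, Q' (k + 1) →ₗ[R] Q' k := fun k => match k with
    | 0 => i ∘ₗ ε
    | k + 1 => d k
  refine ⟨Q', d', f, hf, exact_comp_of_surjective hif hε, ?_, ?_, ?_⟩
  · rintro (_ | k)
    · exact exact_comp_of_injective h0 hi
    · exact hd k
  · rintro (_ | k)
    · exact ‹Module.Projective R P›
    · exact hQ k
  · rintro (_ | k) hk
    · exact ‹Module.Finite R P›
    · exact hfin k (by omega)

/-- A mapping cone argument. Lift f to ψ : P → Q 0. The map s on Q 1 × P is surjective onto a
projective module, hence split, so its kernel is projective, and finitely generated if Q 1 is. That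
kernel maps onto Z through its P-coordinate, and Q 2, Q 3, … continue the resolution. -/
theorem HasResolution.syzygy {N : Type v} {P Z : Type (max u v)} [AddCommGroup N] [Module R N]
    [AddCommGroup P] [Module R P] [AddCommGroup Z] [Module R Z]
    [Module.Finite R P] [Module.Projective R P] {i : Z →ₗ[R] P} {f : P →ₗ[R] N}
    (hi : Function.Injective i) (hf : Function.Surjective f) (hif : Function.Exact i f) {n : ℕ}
    (h : HasResolution R N (n + 1)) : HasResolution R Z n := by
  obtain ⟨Q, d, ε, hε, h0, hd, hQ, hfin⟩ := h
  obtain ⟨ψ, hψ⟩ := Module.projective_lifting_property ε f hε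
  have hψ' (p : P) : ε (ψ p) = f p := LinearMap.congr_fun hψ p
  -- degree one cycles of the mapping cone
  let s : (Q 1 × P) →ₗ[R] Q 0 := (d 0).coprod (-ψ)
  have hs (x : Q 1 × P) : s x = d 0 x.1 - ψ x.2 := by simp [s, sub_eq_add_neg]
  have hssurj : Function.Surjective s := by
    intro x
    obtain ⟨p, hp⟩ := hf (-ε x)
    obtain ⟨q, hq⟩ := (h0 (x + ψ p)).1 (by rw [map_add, hψ', hp, add_neg_cancel])
    exact ⟨(q, p), by rw [hs, hq, add_sub_cancel_right]⟩
  have hproj1 : Module.Projective R (Q 1) := hQ 1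
  have hproj0 : Module.Projective R (Q 0) := hQ 0
  obtain ⟨t, ht⟩ := Module.projective_lifting_property s LinearMap.id hssurj
  have ht' (x : Q 0) : s (t x) = x := LinearMap.congr_fun ht x
  -- The projection onto `ker s` along the image of the section `t`.
  let r : (Q 1 × P) →ₗ[R] ker s :=
    (LinearMap.id - t ∘ₗ s).codRestrict (ker s) fun x => by simp [ht']
  have hr : r ∘ₗ (ker s).subtype = LinearMap.id := by
    ext x : 2
    simp [r]
  have hproj : Module.Projective R (ker s) := .of_split _ _ hr
  have hZ (x : ker s) : f x.1.2 = 0 := by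
    have hx : d 0 x.1.1 = ψ x.1.2 := sub_eq_zero.1 ((hs x.1).symm.trans x.2)
    rw [← hψ', ← hx]
    exact (h0 _).2 ⟨_, rfl⟩
  let iZ : Z ≃ₗ[R] range i := LinearEquiv.ofInjective i hi
  let η : ker s →ₗ[R] Z := iZ.symm.toLinearMap ∘ₗ
    (LinearMap.snd R _ _ ∘ₗ (ker s).subtype).codRestrict (range i) fun x => (hif _).1 (hZ x)
  have hη (x : ker s) : i (η x) = x.1.2 := by
    have : iZ (η x) = ⟨x.1.2, (hif _).1 (hZ x)⟩ := by simp [η]; rfl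
    exact congrArg Subtype.val this
  let δ : Q 2 →ₗ[R] ker s :=
    (LinearMap.inl R (Q 1) P ∘ₗ d 1).codRestrict (ker s) fun x => by
      rw [LinearMap.mem_ker, hs]
      simpa using (hd 0 _).2 ⟨x, rfl⟩
  have hδ (x : Q 2) : (δ x).1 = (d 1 x, 0) := rfl
  have hδη : Function.Exact δ η := by
    intro x
    rw [← map_eq_zero_iff i hi, hη]
    constructor
    · intro hx
      obtain ⟨y, hy⟩ := (hd 0 x.1.1).1 <| by
        have := (hs x.1).symm.trans x.2
        simpa [hx] using this
      exact ⟨y, Subtype.ext (by rw [Prod.ext_iff]; exact ⟨hy, hx.symm⟩)⟩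
    · rintro ⟨y, rfl⟩
      rfl
  have hdδ : Function.Exact (d 2) δ := by
    intro x
    rw [← hd 1 x, Subtype.ext_iff, hδ, Prod.ext_iff]
    exact and_iff_left rfl
  have hηsurj : Function.Surjective η := by
    intro z
    obtain ⟨q, hq⟩ := (h0 (ψ (i z))).1 (by rw [hψ']; exact (hif _).2 ⟨z, rfl⟩)
    exact ⟨⟨(q, i z), by simp [hs, hq]⟩, hi (hη _)⟩
  have hfin0 (hn : 0 < n) : Module.Finite R (ker s) := by
    have : Module.Finite R (Q 1) := hfin 1 (by omega)
    exact Module.Finite.of_surjective r fun x => ⟨x, LinearMap.congr_fun hr x⟩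
  let Q' : ℕ → ModuleCat.{max u v} R := prependTerm (ModuleCat.of R (ker s)) fun k => Q (k + 2)
  let d' : ∀ k, Q' (k + 1) →ₗ[R] Q' k := fun k => match k with
    | 0 => δ
    | k + 1 => d (k + 2)
  refine ⟨Q', d', η, hηsurj, hδη, ?_, ?_, ?_⟩
  · rintro (_ | k)
    · exact hdδ
    · exact hd (k + 2)
  · rintro (_ | k)
    · exact hproj
    · exact hQ (k + 2)
  · rintro (_ | k) hk
    · exact hfin0 hk
    · exact hfin (k + 2) (by omega)

theorem moduleIsFP_zero_iff_of_universe {N : Type (max u v)} [AddCommGroup N] [Module R N] :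
    ModuleIsFP R N 0 ↔ Module.Finite R N := by
  constructor
  · rintro ⟨P, d, ε, hε, -, -, -, hf⟩
    have := hf 0 le_rfl
    exact Module.Finite.of_surjective ε hε
  · intro h
    obtain ⟨m, f, hf⟩ := Module.Finite.exists_fin' R N
    -- The free module is lifted to the universe in which the terms of a resolution must live.
    let e : ULift.{max u v} (Fin m → R) ≃ₗ[R] (Fin m → R) := ULift.moduleEquiv
    have : Module.Projective R (ULift.{max u v} (Fin m → R)) := .of_equiv e.symm
    rw [moduleIsFP_iff_hasResolution]
    exact HasResolution.splice (i := (ker (f ∘ₗ e.toLinearMap)).subtype) Subtype.val_injective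
      (hf.comp e.surjective) (exact_subtype_ker_map _) (hasResolution_zero _)

theorem moduleIsFP_succ_iff_of_universe {N P Z : Type (max u v)} [AddCommGroup N] [Module R N]
    [AddCommGroup P] [Module R P] [AddCommGroup Z] [Module R Z]
    [Module.Finite R P] [Module.Projective R P] {i : Z →ₗ[R] P} {f : P →ₗ[R] N}
    (hi : Function.Injective i) (hf : Function.Surjective f) (hif : Function.Exact i f) {n : ℕ} :
    ModuleIsFP R N (n + 1) ↔ ModuleIsFP R Z n := by
  rw [moduleIsFP_iff_hasResolution, moduleIsFP_iff_hasResolution]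
  exact ⟨.syzygy hi hf hif, .splice hi hf hif⟩

theorem ModuleIsFP.of_le {N : Type v} [AddCommGroup N] [Module R N] {m n : ℕ} (hmn : m ≤ n)
    (h : ModuleIsFP R N n) : ModuleIsFP R N m := by
  obtain ⟨P, d, ε, hε, h0, hd, hP, hf⟩ := h
  exact ⟨P, d, ε, hε, h0, hd, hP, fun i hi => hf i (hi.trans hmn)⟩

/-- A resolution need not descend to a smaller universe, but a finitely generated free cover exists
in each. Induction on n compares the kernels of the same cover taken in two universes. -/
theorem moduleIsFP_congr_of_universe {N : Type (max u v)} {N' : Type (max u w)} [AddCommGroup N]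
    [Module R N] [AddCommGroup N'] [Module R N'] (e : N ≃ₗ[R] N') (n : ℕ) :
    ModuleIsFP R N n ↔ ModuleIsFP R N' n := by
  induction n generalizing N N' with
  | zero =>
    rw [moduleIsFP_zero_iff_of_universe, moduleIsFP_zero_iff_of_universe]
    exact Module.Finite.equiv_iff e
  | succ n ih =>
    by_cases h : Module.Finite R N
    · obtain ⟨m, f, hf⟩ := Module.Finite.exists_fin' R N
      let p : ULift.{max u v} (Fin m → R) ≃ₗ[R] (Fin m → R) := ULift.moduleEquiv
      have : Module.Projective R (ULift.{max u v} (Fin m → R)) := .of_equiv p.symm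
      let p' : ULift.{max u w} (Fin m → R) ≃ₗ[R] (Fin m → R) := ULift.moduleEquiv
      have : Module.Projective R (ULift.{max u w} (Fin m → R)) := .of_equiv p'.symm
      let F := f ∘ₗ p.toLinearMap
      let F' := (e.toLinearMap ∘ₗ f) ∘ₗ p'.toLinearMap
      have hF : Function.Surjective F := hf.comp p.surjective
      have hF' : Function.Surjective F' := (e.surjective.comp hf).comp p'.surjective
      rw [moduleIsFP_succ_iff_of_universe (ker F).injective_subtype hF (exact_subtype_ker_map F),
        moduleIsFP_succ_iff_of_universe (ker F').injective_subtype hF' (exact_subtype_ker_map F')]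
      refine ih ((p.trans p'.symm).submoduleMap (ker F) |>.trans (LinearEquiv.ofEq _ _ ?_))
      ext x
      simp [F, F', Submodule.map_equiv_eq_comap_symm]
    · refine iff_of_false (fun h' => h ?_) fun h' => h ?_
      · exact moduleIsFP_zero_iff_of_universe.1 (h'.of_le (Nat.zero_le _))
      · exact (Module.Finite.equiv_iff e).2
          (moduleIsFP_zero_iff_of_universe.1 (h'.of_le (Nat.zero_le _)))

theorem moduleIsFP_ulift_iff {N : Type v} [AddCommGroup N] [Module R N] (n : ℕ) :
    ModuleIsFP R (ULift.{max u v} N) n ↔ ModuleIsFP R N n := by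
  rw [moduleIsFP_iff_hasResolution, moduleIsFP_iff_hasResolution]
  exact (HasResolution.of_same_universe ULift.moduleEquiv.symm).symm

theorem moduleIsFP_congr {N : Type v} {N' : Type w} [AddCommGroup N]
    [Module R N] [AddCommGroup N'] [Module R N'] (e : N ≃ₗ[R] N') (n : ℕ) :
    ModuleIsFP R N n ↔ ModuleIsFP R N' n := by
  rw [← moduleIsFP_ulift_iff (N := N), ← moduleIsFP_ulift_iff (N := N')]
  exact moduleIsFP_congr_of_universe.{u, v, w}
    (ULift.moduleEquiv.trans (e.trans ULift.moduleEquiv.symm)) n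

theorem moduleIsFP_zero_iff {N : Type v} [AddCommGroup N] [Module R N] :
    ModuleIsFP R N 0 ↔ Module.Finite R N := by
  rw [← moduleIsFP_ulift_iff, moduleIsFP_zero_iff_of_universe.{u, v}]
  exact Module.Finite.equiv_iff ULift.moduleEquiv

theorem ModuleIsFP.finite {N : Type v} [AddCommGroup N] [Module R N] {n : ℕ}
    (h : ModuleIsFP R N n) : Module.Finite R N :=
  moduleIsFP_zero_iff.1 (h.of_le (Nat.zero_le _))

/-- If `0 → Z → P → N → 0` is exact with `P` finitely generated projective, then `N` is of type
`FP_{n+1}` if and only if `Z` is of type `FP_n`. -/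
theorem moduleIsFP_succ_iff.{p, z} {N : Type v} {P : Type p} {Z : Type z} [AddCommGroup N]
    [Module R N] [AddCommGroup P] [Module R P] [AddCommGroup Z] [Module R Z]
    [Module.Finite R P] [Module.Projective R P] {i : Z →ₗ[R] P} {f : P →ₗ[R] N}
    (hi : Function.Injective i) (hf : Function.Surjective f) (hif : Function.Exact i f) {n : ℕ} :
    ModuleIsFP R N (n + 1) ↔ ModuleIsFP R Z n := by
  let eN : N ≃ₗ[R] ULift.{max u v p z} N := ULift.moduleEquiv.symm
  let eP : P ≃ₗ[R] ULift.{max u v p z} P := ULift.moduleEquiv.symm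
  let eZ : Z ≃ₗ[R] ULift.{max u v p z} Z := ULift.moduleEquiv.symm
  rw [moduleIsFP_congr eN, moduleIsFP_congr eZ]
  have : Module.Projective R (ULift.{max u v p z} P) := .of_equiv eP
  have : Module.Finite R (ULift.{max u v p z} P) := .equiv eP
  let i' := eP.toLinearMap ∘ₗ i ∘ₗ eZ.symm.toLinearMap
  let f' := eN.toLinearMap ∘ₗ f ∘ₗ eP.symm.toLinearMap
  refine moduleIsFP_succ_iff_of_universe.{u, max v p z} (i := i') (f := f')
    (eP.injective.comp (hi.comp eZ.symm.injective)) (eN.surjective.comp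
      (hf.comp eP.symm.surjective)) fun x => ?_
  obtain ⟨y, rfl⟩ := eP.surjective x
  have h := hif y
  constructor
  · intro hy
    obtain ⟨z, rfl⟩ := h.1 (by simpa [f'] using hy)
    exact ⟨eZ z, by simp [i']⟩
  · rintro ⟨z, hz⟩
    have : f y = 0 := h.2 ⟨eZ.symm z, eP.injective (by simpa [i'] using hz)⟩
    simp [f', this]

end Resolutions

/-! ### Fox calculus: the relation module as the kernel of the Fox boundary. -/

section RelationSequence

open MonoidAlgebra

variable {G : Type u} [Group G]

theorem MonoidAlgebra.single_one_smul_smul {M V : Type*} [Monoid M] [AddCommGroup V]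
    [Module (MonoidAlgebra ℤ M) V] (g h : M) (v : V) :
    (single g (1 : ℤ)) • (single h (1 : ℤ)) • v = (single (g * h) (1 : ℤ)) • v := by
  rw [smul_smul, single_mul_single, mul_one]

theorem MonoidAlgebra.single_one_smul_of_eq_one {M V : Type*} [Monoid M] [AddCommGroup V]
    [Module (MonoidAlgebra ℤ M) V] {g : M} (hg : g = 1) (v : V) :
    (single g (1 : ℤ)) • v = v := by
  rw [hg, ← one_def, one_smul]

/-- The additive map from `ℤ[M]` with prescribed values on `M`. -/
noncomputable def MonoidAlgebra.liftAdd {M T : Type*} [AddCommGroup T] (f : M → T) :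
    MonoidAlgebra ℤ M →+ T :=
  (Finsupp.liftAddHom fun g => zmultiplesHom T (f g)).comp coeffAddEquiv.toAddMonoidHom

@[simp]
theorem MonoidAlgebra.liftAdd_single {M T : Type*} [AddCommGroup T] (f : M → T) (m : M) (k : ℤ) :
    liftAdd f (single m k) = k • f m := by
  simp [liftAdd]

theorem MonoidAlgebra.int_addHom_ext {M T : Type*} [AddCommGroup T] {f g : MonoidAlgebra ℤ M →+ T}
    (h : ∀ m, f (single m 1) = g (single m 1)) : f = g := by
  refine addMonoidHom_ext fun m k => ?_
  have : (single m k : MonoidAlgebra ℤ M) = k • single m 1 := by simp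
  rw [this, map_zsmul, map_zsmul, h]

theorem MonoidAlgebra.finsupp_addHom_ext {X M T : Type*} [AddCommGroup T]
    {f g : (X →₀ MonoidAlgebra ℤ M) →+ T}
    (h : ∀ x m, f (.single x (single m 1)) = g (.single x (single m 1))) : f = g :=
  Finsupp.addHom_ext' fun x => int_addHom_ext fun m => h x m

/-- An additive map that commutes with the action of `M` is `ℤ[M]`-linear. -/
def MonoidAlgebra.linearMapOfAddHom {M V W : Type*} [Monoid M] [AddCommGroup V]
    [Module (MonoidAlgebra ℤ M) V] [AddCommGroup W] [Module (MonoidAlgebra ℤ M) W] (f : V →+ W)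
    (h : ∀ (m : M) v, f (single m (1 : ℤ) • v) = single m (1 : ℤ) • f v) :
    V →ₗ[MonoidAlgebra ℤ M] W where
  __ := f
  map_smul' r v := by
    have : ((f.comp (AddMonoidHom.flip (smulAddHom (MonoidAlgebra ℤ M) V) v))) =
        AddMonoidHom.flip (smulAddHom (MonoidAlgebra ℤ M) W) (f v) :=
      int_addHom_ext fun m => h m v
    exact DFunLike.congr_fun this r

@[simp]
theorem MonoidAlgebra.linearMapOfAddHom_apply {M V W : Type*} [Monoid M] [AddCommGroup V]
    [Module (MonoidAlgebra ℤ M) V] [AddCommGroup W] [Module (MonoidAlgebra ℤ M) W] (f : V →+ W)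
    (h : ∀ (m : M) v, f (single m (1 : ℤ) • v) = single m (1 : ℤ) • f v) (v : V) :
    linearMapOfAddHom f h v = f v := rfl

variable {X : Type v} (ψ : FreeGroup X →* G)

/-- The affine permutation of the free module `ℤG^(X)` given by a free generator. -/
noncomputable def foxPerm (x : X) : Equiv.Perm (X →₀ MonoidAlgebra ℤ G) where
  toFun v := single (ψ (.of x)) (1 : ℤ) • v + Finsupp.single x 1
  invFun v := single (ψ (.of x))⁻¹ (1 : ℤ) • (v - Finsupp.single x 1)
  left_inv v := by
    beta_reduce
    rw [add_sub_cancel_right, single_one_smul_smul]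
    exact single_one_smul_of_eq_one (inv_mul_cancel _) v
  right_inv v := by
    beta_reduce
    rw [single_one_smul_smul, single_one_smul_of_eq_one (mul_inv_cancel _), sub_add_cancel]

/-- The vector of Fox derivatives of a word, with values in `ℤG^(X)`. -/
noncomputable def foxDerivative (w : FreeGroup X) : X →₀ MonoidAlgebra ℤ G :=
  FreeGroup.lift (foxPerm ψ) w 0

/-- A word acts as an affine map with linear part ψ w, and its value at 0 is the translation part.
Composing affine maps yields the product rule without reduced words. -/
theorem lift_foxPerm_apply (w : FreeGroup X) (v : X →₀ MonoidAlgebra ℤ G) :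
    FreeGroup.lift (foxPerm ψ) w v = single (ψ w) (1 : ℤ) • v + foxDerivative ψ w := by
  unfold foxDerivative
  induction w using FreeGroup.induction_on generalizing v with
  | C1 => simp [single_one_smul_of_eq_one]
  | of x => simp [foxPerm]
  | inv_of x _ =>
    simp [foxPerm, Equiv.Perm.inv_def, sub_eq_add_neg]
  | mul u w hu hw =>
    rw [map_mul, Equiv.Perm.mul_apply, Equiv.Perm.mul_apply, hu, hw, hu (FreeGroup.lift (foxPerm ψ) w 0),
      smul_add, single_one_smul_smul, map_mul, add_assoc]

theorem foxDerivative_mul (u w : FreeGroup X) :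
    foxDerivative ψ (u * w) = single (ψ u) (1 : ℤ) • foxDerivative ψ w + foxDerivative ψ u := by
  rw [foxDerivative, map_mul, Equiv.Perm.mul_apply, lift_foxPerm_apply]
  rfl

@[simp]
theorem foxDerivative_one : foxDerivative ψ 1 = 0 := by
  simp [foxDerivative]

@[simp]
theorem foxDerivative_of (x : X) : foxDerivative ψ (.of x) = Finsupp.single x 1 := by
  simp [foxDerivative, foxPerm]

theorem foxDerivative_inv (w : FreeGroup X) :
    foxDerivative ψ w⁻¹ = -(single (ψ w)⁻¹ (1 : ℤ) • foxDerivative ψ w) := by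
  have h := foxDerivative_mul ψ w⁻¹ w
  rw [inv_mul_cancel, foxDerivative_one, map_inv] at h
  exact eq_neg_of_add_eq_zero_right h.symm

/-- Covers two kinds of relator: conjugates (z = u) and the Reidemeister–Schreier relators of
`rewriteClass`. -/
theorem foxDerivative_mul_inv_mul (u w : FreeGroup X) (z : FreeGroup X)
    (h : ψ u * ψ w = ψ z) :
    foxDerivative ψ (u * w * z⁻¹) =
      single (ψ u) (1 : ℤ) • foxDerivative ψ w + foxDerivative ψ u - foxDerivative ψ z := by
  rw [foxDerivative_mul, foxDerivative_inv, smul_neg, single_one_smul_smul,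
    single_one_smul_of_eq_one (by rw [map_mul, h, mul_inv_cancel]), foxDerivative_mul]
  abel

/-- The map `ℤG^(X) → ℤG` that sends the basis vector of `x` to `ψ x - 1`. -/
noncomputable def foxBoundary : (X →₀ MonoidAlgebra ℤ G) →ₗ[MonoidAlgebra ℤ G] MonoidAlgebra ℤ G :=
  Finsupp.linearCombination _ fun x => single (ψ (.of x)) 1 - 1

theorem foxBoundary_single (x : X) (g : G) :
    foxBoundary ψ (.single x (single g 1)) = single (g * ψ (.of x)) 1 - single g 1 := by
  simp [foxBoundary, mul_sub]

/-- The fundamental formula of Fox calculus: boundaries telescope along the path labelled w in the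
Cayley graph. -/
theorem foxBoundary_foxDerivative (w : FreeGroup X) :
    foxBoundary ψ (foxDerivative ψ w) = single (ψ w) 1 - 1 := by
  induction w using FreeGroup.induction_on with
  | C1 => simp [one_def]
  | of x =>
    rw [foxDerivative_of]
    simpa [one_def] using foxBoundary_single ψ x 1
  | inv_of x h =>
    rw [foxDerivative_inv, map_neg, map_smul, h]
    simp [mul_sub, one_def]
  | mul u w hu hw =>
    rw [foxDerivative_mul, map_add, map_smul, hu, hw]
    simp [mul_sub]

theorem foxDerivative_ker_mul {r : FreeGroup X} (hr : ψ r = 1) (w : FreeGroup X) :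
    foxDerivative ψ (r * w) = foxDerivative ψ w + foxDerivative ψ r := by
  rw [foxDerivative_mul, single_one_smul_of_eq_one hr]

/-- The Fox derivative on the abelianized kernel. -/
noncomputable def foxDerivativeAb :
    Additive (Abelianization ψ.ker) →+ (X →₀ MonoidAlgebra ℤ G) :=
  MonoidHom.toAdditiveLeft (Abelianization.lift
    { toFun := fun r => Multiplicative.ofAdd (foxDerivative ψ r)
      map_one' := by simp
      map_mul' := fun r t => by
        rw [← ofAdd_add, Subgroup.coe_mul, foxDerivative_ker_mul ψ r.2, add_comm] })

/-- The class of a relator in the relation module. -/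
def relatorClass (r : FreeGroup X) (hr : ψ r = 1) : Additive (Abelianization ψ.ker) :=
  .ofMul (.of ⟨r, hr⟩)

theorem foxDerivativeAb_relatorClass (r : FreeGroup X) (hr : ψ r = 1) :
    foxDerivativeAb ψ (relatorClass ψ r hr) = foxDerivative ψ r := by
  rfl

theorem relatorClass_mul {r t : FreeGroup X} (hr : ψ r = 1) (ht : ψ t = 1) :
    relatorClass ψ (r * t) (by rw [map_mul, hr, ht, one_mul]) =
      relatorClass ψ r hr + relatorClass ψ t ht := rfl

theorem exists_relatorClass (z : Additive (Abelianization ψ.ker)) :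
    ∃ r hr, z = relatorClass ψ r hr := by
  obtain ⟨r, hr⟩ := QuotientGroup.mk_surjective (Additive.toMul z)
  exact ⟨r.1, r.2, hr.symm⟩

/-- Conjugation inside the kernel is trivial after abelianization. This is needed because the
representative chosen for 1 ∈ G may be a nontrivial word. -/
theorem relatorClass_conj {r : FreeGroup X} (hr : ψ r = 1) {t : FreeGroup X} (ht : ψ t = 1)
    {z : FreeGroup X} (hz : z = t * r * t⁻¹) :
    relatorClass ψ z (by simp [hz, hr]) = relatorClass ψ r hr := by
  subst hz
  have h1 := relatorClass_mul ψ (r := t * r * t⁻¹) (t := t) (by simp [hr]) ht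
  have h2 := relatorClass_mul ψ ht hr
  simp only [inv_mul_cancel_right] at h1
  rw [h2, add_comm] at h1
  exact (add_right_cancel h1).symm

variable {ψ} (hψ : Function.Surjective ψ)

/-- The relator by which a word read from the vertex `g` of the Cayley graph fails to be the
chosen representative of its endpoint. -/
noncomputable def rewriteClass (g : G) (w : FreeGroup X) : Additive (Abelianization ψ.ker) :=
  relatorClass ψ (Function.surjInv hψ g * w * (Function.surjInv hψ (g * ψ w))⁻¹) (by
    simp [Function.surjInv_eq hψ])

theorem rewriteClass_mul (g : G) (u w : FreeGroup X) :
    rewriteClass hψ g (u * w) = rewriteClass hψ g u + rewriteClass hψ (g * ψ u) w := by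
  rw [rewriteClass, rewriteClass, rewriteClass, ← relatorClass_mul]
  congr 1
  simp [mul_assoc]

theorem rewriteClass_one (g : G) : rewriteClass hψ g 1 = 0 := by
  have := rewriteClass_mul hψ g 1 1
  simpa using this

/-- The Reidemeister–Schreier map from `ℤG^(X)` to the relation module. -/
noncomputable def rewriteMap :
    (X →₀ MonoidAlgebra ℤ G) →+ Additive (Abelianization ψ.ker) :=
  Finsupp.liftAddHom fun x => liftAdd fun g => rewriteClass hψ g (.of x)

theorem rewriteMap_single (x : X) (g : G) :
    rewriteMap hψ (.single x (single g 1)) = rewriteClass hψ g (.of x) := by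
  simp [rewriteMap]

/-- The translated Fox derivative lists, with signs, the edges of the path labelled w that starts at
g, and `rewriteClass` is additive along paths. -/
theorem rewriteMap_foxDerivative (g : G) (w : FreeGroup X) :
    rewriteMap hψ (single g (1 : ℤ) • foxDerivative ψ w) = rewriteClass hψ g w := by
  induction w using FreeGroup.induction_on generalizing g with
  | C1 => simp [rewriteClass_one]
  | of x => simp [← rewriteMap_single]
  | inv_of x h =>
    have h1 := rewriteClass_mul hψ g (.of x)⁻¹ (.of x)
    rw [inv_mul_cancel, rewriteClass_one] at h1
    rw [foxDerivative_inv, smul_neg, map_neg, single_one_smul_smul, h]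
    rw [map_inv] at h1
    exact (eq_neg_of_add_eq_zero_left h1.symm).symm
  | mul u w hu hw =>
    rw [foxDerivative_mul, smul_add, single_one_smul_smul, map_add, hu, hw, rewriteClass_mul,
      add_comm]

theorem rewriteMap_foxDerivativeAb (z : Additive (Abelianization ψ.ker)) :
    rewriteMap hψ (foxDerivativeAb ψ z) = z := by
  obtain ⟨r, hr, rfl⟩ := exists_relatorClass ψ z
  rw [foxDerivativeAb_relatorClass, ← single_one_smul_of_eq_one (M := G) rfl (foxDerivative ψ r),
    rewriteMap_foxDerivative, rewriteClass]
  exact relatorClass_conj ψ hr (Function.surjInv_eq hψ 1) (by rw [hr, mul_one])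

/-- The correction term factors through the boundary, so on cycles `rewriteMap` is a right inverse
as well; this gives surjectivity onto the kernel. -/
theorem foxDerivativeAb_rewriteMap (v : X →₀ MonoidAlgebra ℤ G) :
    foxDerivativeAb ψ (rewriteMap hψ v) =
      v - liftAdd (fun g => foxDerivative ψ (Function.surjInv hψ g)) (foxBoundary ψ v) := by
  have : (foxDerivativeAb ψ).comp (rewriteMap hψ) = AddMonoidHom.id _ -
      (liftAdd (fun g => foxDerivative ψ (Function.surjInv hψ g))).comp
        (foxBoundary ψ).toAddMonoidHom := by
    refine finsupp_addHom_ext fun x g => ?_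
    simp only [AddMonoidHom.comp_apply, AddMonoidHom.sub_apply, AddMonoidHom.id_apply,
      LinearMap.toAddMonoidHom_coe, foxBoundary_single, rewriteMap_single, rewriteClass,
      foxDerivativeAb_relatorClass, map_sub, liftAdd_single, one_smul]
    rw [foxDerivative_mul_inv_mul _ _ _ _ (by simp [Function.surjInv_eq hψ])]
    simp [Function.surjInv_eq hψ]
    abel
  exact DFunLike.congr_fun this v

theorem foxBoundary_foxDerivativeAb (z : Additive (Abelianization ψ.ker)) :
    foxBoundary ψ (foxDerivativeAb ψ z) = 0 := by
  obtain ⟨r, hr, rfl⟩ := exists_relatorClass ψ z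
  rw [foxDerivativeAb_relatorClass, foxBoundary_foxDerivative, hr, one_def, sub_self]

theorem foxDerivativeAb_rep (g : G) (z : Additive (Abelianization ψ.ker)) :
    foxDerivativeAb ψ (RelationModule.rep ψ hψ g z) =
      single g (1 : ℤ) • foxDerivativeAb ψ z := by
  obtain ⟨r, hr, rfl⟩ := exists_relatorClass ψ z
  obtain ⟨f, rfl⟩ := hψ g
  rw [RelationModule.rep_apply, relatorClass, RelationModule.conjRep_of]
  change foxDerivative ψ (f * r * f⁻¹) = single (ψ f) (1 : ℤ) • foxDerivative ψ r
  rw [foxDerivative_mul_inv_mul _ _ _ _ (by rw [hr, mul_one]), add_sub_cancel_right]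

/-- The relation module as the kernel of the boundary map of the Cayley graph. -/
noncomputable def relationModuleEquiv :
    (RelationModule.rep ψ hψ).asModule ≃ₗ[MonoidAlgebra ℤ G] LinearMap.ker (foxBoundary ψ) :=
  LinearEquiv.ofBijective
    ((linearMapOfAddHom (V := (RelationModule.rep ψ hψ).asModule) (foxDerivativeAb ψ) fun g z =>
      (congrArg (foxDerivativeAb ψ) ((Representation.single_smul (RelationModule.rep ψ hψ) 1 g z).trans
        (one_smul ℤ _))).trans (foxDerivativeAb_rep hψ g z)).codRestrict _ fun z => foxBoundary_foxDerivativeAb z) <| by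
    constructor
    · intro z z' h
      have : foxDerivativeAb ψ z = foxDerivativeAb ψ z' := congrArg Subtype.val h
      rw [← rewriteMap_foxDerivativeAb hψ z, this]
      exact rewriteMap_foxDerivativeAb hψ z'
    · intro v
      refine ⟨rewriteMap hψ v.1, Subtype.ext ?_⟩
      refine (foxDerivativeAb_rewriteMap hψ v.1).trans ?_
      rw [v.2, map_zero, sub_zero]

theorem relationModuleIsFP_iff (n : ℕ) :
    RelationModuleIsFP ψ hψ n ↔
      ModuleIsFP (MonoidAlgebra ℤ G) (LinearMap.ker (foxBoundary ψ)) n :=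
  moduleIsFP_congr (relationModuleEquiv hψ) n

end RelationSequence

/-! ### Induction of modules from ℤG to ℤM. -/

section InducedModule

open MonoidAlgebra

theorem MonoidAlgebra.smul_mem_of_forall_single {M V : Type*} [Monoid M] [AddCommGroup V]
    [Module (MonoidAlgebra ℤ M) V] {H : AddSubgroup V} {v : V}
    (h : ∀ m : M, single m (1 : ℤ) • v ∈ H) (r : MonoidAlgebra ℤ M) : r • v ∈ H := by
  induction r using MonoidAlgebra.induction_linear with
  | zero => simp
  | add r s hr hs => rw [add_smul]; exact H.add_mem hr hs
  | single m k =>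
    have : (single m k : MonoidAlgebra ℤ M) = k • single m 1 := by simp
    rw [this, smul_assoc]
    exact H.zsmul_mem (h m) k

/-- An additive subgroup stable under the action of `M`, as a submodule over `ℤ[M]`. -/
def MonoidAlgebra.submoduleOfAddSubgroup {M V : Type*} [Monoid M] [AddCommGroup V]
    [Module (MonoidAlgebra ℤ M) V] (H : AddSubgroup V)
    (h : ∀ (m : M), ∀ v ∈ H, single m (1 : ℤ) • v ∈ H) : Submodule (MonoidAlgebra ℤ M) V where
  __ := H
  smul_mem' r v hv := smul_mem_of_forall_single (fun m => h m v hv) r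

variable {G : Type u} {A : Type v} {B : Type w} (C : B → A → G)

/-- The module over the monoid ring of the Rees matrix monoid induced from a `ℤG`-module `N`
along the left ideal generated by the idempotent `(a₀, 1, b₀)`. -/
def Ind (_ : B → A → G) (N : Type x) [AddCommGroup N] : Type (max v x) := A →₀ N

namespace Ind

variable (N : Type x) [AddCommGroup N]

noncomputable instance : AddCommGroup (Ind C N) := inferInstanceAs (AddCommGroup (A →₀ N))

variable {N}

/-- The inclusion of the component at `a`. -/
noncomputable def single (a : A) : N →+ Ind C N := Finsupp.singleAddHom a

variable {C}

/-- The projection to the component at `a`. -/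
noncomputable def coord (a : A) : Ind C N →+ N := Finsupp.applyAddHom a

/-- The additive map with prescribed values on the components. -/
noncomputable def lift {T : Type*} [AddCommGroup T] (f : A → N →+ T) : Ind C N →+ T :=
  Finsupp.liftAddHom f

@[simp]
theorem lift_single {T : Type*} [AddCommGroup T] (f : A → N →+ T) (a : A) (y : N) :
    lift f (single C a y) = f a y :=
  Finsupp.liftAddHom_apply_single f a y

theorem addHom_ext {T : Type*} [AddCommGroup T] {f g : Ind C N →+ T}
    (h : ∀ a y, f (single C a y) = g (single C a y)) : f = g :=
  Finsupp.addHom_ext h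

theorem coord_single_same (a : A) (y : N) : coord a (single C a y) = y :=
  Finsupp.single_eq_same

theorem coord_single_of_ne {a a' : A} (h : a ≠ a') (y : N) : coord a (single C a' y) = 0 :=
  Finsupp.single_eq_of_ne h

theorem ext {x y : Ind C N} (h : ∀ a, coord a x = coord a y) : x = y := Finsupp.ext h

theorem mem_of_coord {H : AddSubgroup (Ind C N)} {x : Ind C N}
    (h : ∀ a, single C a (coord a x) ∈ H) : x ∈ H := by
  have : x = Finsupp.sum (M := N) x fun a y => single C a y := (Finsupp.sum_single x).symm
  rw [this]
  exact AddSubgroup.sum_mem _ fun a _ => h a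

theorem finite_coord_ne_zero (x : Ind C N) : {a | coord a x ≠ 0}.Finite :=
  Finsupp.hasFiniteSupport x

variable [Group G] [Module (MonoidAlgebra ℤ G) N]

/-- The sum of the components weighted by the entries of the row `b` of the sandwich matrix. -/
noncomputable def weightedSum (b : B) : Ind C N →+ N :=
  lift fun a => DistribSMul.toAddMonoidHom N (MonoidAlgebra.single (C b a) (1 : ℤ))

@[simp]
theorem weightedSum_single (b : B) (a : A) (y : N) :
    weightedSum b (single C a y) = MonoidAlgebra.single (C b a) (1 : ℤ) • y := by
  simp [weightedSum]

theorem weightedSum_mem (b : B) {x : Ind C N} (W : Submodule (MonoidAlgebra ℤ G) N)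
    (h : ∀ a, coord a x ∈ W) : weightedSum b x ∈ W := by
  have : x ∈ W.toAddSubgroup.comap (weightedSum b) := mem_of_coord fun a => by
    rw [AddSubgroup.mem_comap, weightedSum_single]
    exact W.smul_mem _ (h a)
  exact this

variable (C N) in
/-- The action of the Rees matrix monoid on the induced module. -/
noncomputable def rep : WithOne (ReesMatrix C) →* Module.End ℤ (Ind C N) :=
  WithOne.lift
    { toFun := fun s => ((single C s.row).comp ((DistribSMul.toAddMonoidHom N
        (MonoidAlgebra.single s.val (1 : ℤ))).comp (weightedSum s.col))).toIntLinearMap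
      map_mul' := fun s t => by
        ext x
        simp [ReesMatrix.mul_def, single_one_smul_smul, mul_assoc] }

noncomputable instance : Module (MonoidAlgebra ℤ (WithOne (ReesMatrix C))) (Ind C N) :=
  Module.compHom _ (MonoidAlgebra.lift ℤ (Module.End ℤ (Ind C N)) _ (rep C N)).toRingHom

theorem coe_smul (s : ReesMatrix C) (x : Ind C N) :
    MonoidAlgebra.single (s : WithOne (ReesMatrix C)) (1 : ℤ) • x =
      single C s.row (MonoidAlgebra.single s.val (1 : ℤ) • weightedSum s.col x) := by
  change MonoidAlgebra.lift ℤ (Module.End ℤ (Ind C N)) _ (rep C N) (MonoidAlgebra.single _ 1) x = _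
  rw [MonoidAlgebra.lift_single, one_smul, rep, WithOne.lift_coe]
  rfl

/-- An additive map that commutes with the action of the Rees matrix semigroup is linear over the
monoid ring. -/
def _root_.ReesMatrix.linearMapOfAddHom {V W : Type*} [AddCommGroup V]
    [Module (MonoidAlgebra ℤ (WithOne (ReesMatrix C))) V] [AddCommGroup W]
    [Module (MonoidAlgebra ℤ (WithOne (ReesMatrix C))) W] (f : V →+ W)
    (h : ∀ (s : ReesMatrix C) v, f (MonoidAlgebra.single (s : WithOne (ReesMatrix C)) (1 : ℤ) • v) =
      MonoidAlgebra.single (s : WithOne (ReesMatrix C)) (1 : ℤ) • f v) :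
    V →ₗ[MonoidAlgebra ℤ (WithOne (ReesMatrix C))] W :=
  MonoidAlgebra.linearMapOfAddHom f fun m v => by
    induction m using WithOne.recOneCoe with
    | one => rw [single_one_smul_of_eq_one rfl, single_one_smul_of_eq_one rfl]
    | coe s => exact h s v

@[simp]
theorem _root_.ReesMatrix.linearMapOfAddHom_apply {V W : Type*} [AddCommGroup V]
    [Module (MonoidAlgebra ℤ (WithOne (ReesMatrix C))) V] [AddCommGroup W]
    [Module (MonoidAlgebra ℤ (WithOne (ReesMatrix C))) W] (f : V →+ W)
    (h : ∀ (s : ReesMatrix C) v, f (MonoidAlgebra.single (s : WithOne (ReesMatrix C)) (1 : ℤ) • v) =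
      MonoidAlgebra.single (s : WithOne (ReesMatrix C)) (1 : ℤ) • f v) (v : V) :
    ReesMatrix.linearMapOfAddHom f h v = f v := rfl

/-- An additive subgroup stable under the action of the Rees matrix semigroup contains the
submodule generated by any of its subsets. -/
theorem _root_.ReesMatrix.span_subset_of_forall_coe {V : Type*} [AddCommGroup V]
    [Module (MonoidAlgebra ℤ (WithOne (ReesMatrix C))) V] {H : AddSubgroup V} {t : Set V}
    (ht : t ⊆ H)
    (h : ∀ (s : ReesMatrix C), ∀ v ∈ H,
      MonoidAlgebra.single (s : WithOne (ReesMatrix C)) (1 : ℤ) • v ∈ H) {v : V}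
    (hv : v ∈ Submodule.span (MonoidAlgebra ℤ (WithOne (ReesMatrix C))) t) : v ∈ H := by
  have h' : ∀ (m : WithOne (ReesMatrix C)), ∀ v ∈ H, MonoidAlgebra.single m (1 : ℤ) • v ∈ H := by
    intro m v hv
    induction m using WithOne.recOneCoe with
    | one => rwa [single_one_smul_of_eq_one rfl]
    | coe s => exact h s v hv
  exact (Submodule.span_le (p := submoduleOfAddSubgroup H h')).2 ht hv

section Map

variable {N' : Type*} [AddCommGroup N'] [Module (MonoidAlgebra ℤ G) N']
variable {N'' : Type*} [AddCommGroup N''] [Module (MonoidAlgebra ℤ G) N'']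

variable (C) in
/-- Functoriality of the induced module. -/
noncomputable def map (f : N →ₗ[MonoidAlgebra ℤ G] N') :
    Ind C N →ₗ[MonoidAlgebra ℤ (WithOne (ReesMatrix C))] Ind C N' :=
  ReesMatrix.linearMapOfAddHom (lift fun a => (single C a).comp f.toAddMonoidHom) fun s x => by
    have : ((lift fun a => (single C a).comp f.toAddMonoidHom).comp
        (DistribSMul.toAddMonoidHom (Ind C N)
          (MonoidAlgebra.single (s : WithOne (ReesMatrix C)) (1 : ℤ)))) =
        (DistribSMul.toAddMonoidHom (Ind C N')
          (MonoidAlgebra.single (s : WithOne (ReesMatrix C)) (1 : ℤ))).comp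
          (lift fun a => (single C a).comp f.toAddMonoidHom) :=
      addHom_ext fun a y => by simp [coe_smul]
    exact DFunLike.congr_fun this x

@[simp]
theorem map_single (f : N →ₗ[MonoidAlgebra ℤ G] N') (a : A) (y : N) :
    map C f (single C a y) = single C a (f y) :=
  lift_single _ _ _

theorem coord_map (f : N →ₗ[MonoidAlgebra ℤ G] N') (a : A) (x : Ind C N) :
    coord a (map C f x) = f (coord a x) := by
  have : (coord a).comp (map C f).toAddMonoidHom = f.toAddMonoidHom.comp (coord (C := C) a) :=
    addHom_ext fun a' y => by
      by_cases h : a = a'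
      · subst h; simp [coord_single_same]
      · simp [coord_single_of_ne h]
  exact DFunLike.congr_fun this x

theorem map_injective {f : N →ₗ[MonoidAlgebra ℤ G] N'} (hf : Function.Injective f) :
    Function.Injective (map C f) := by
  intro x y h
  refine ext fun a => hf ?_
  rw [← coord_map, h, coord_map]

theorem map_exact {f : N →ₗ[MonoidAlgebra ℤ G] N'} {g : N' →ₗ[MonoidAlgebra ℤ G] N''}
    (h : Function.Exact f g) : Function.Exact (map C f) (map C g) := by
  intro x
  constructor
  · intro hx
    refine mem_of_coord (H := (map C f).toAddMonoidHom.range) fun a => ?_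
    obtain ⟨y, hy⟩ := (h (coord a x)).1 (by rw [← coord_map, hx, map_zero])
    exact ⟨single C a y, by simp [hy]⟩
  · rintro ⟨y, rfl⟩
    refine ext fun a => ?_
    rw [coord_map, coord_map, map_zero]
    exact (h _).2 ⟨_, rfl⟩

theorem map_surjective {f : N →ₗ[MonoidAlgebra ℤ G] N'} (hf : Function.Surjective f) :
    Function.Surjective (map C f) := by
  intro x
  refine mem_of_coord (H := (map C f).toAddMonoidHom.range) fun a => ?_
  obtain ⟨y, hy⟩ := hf (coord a x)
  exact ⟨single C a y, by simp [hy]⟩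

end Map

section Free

variable {X : Type*}

theorem free_addHom_ext {T : Type*} [AddCommGroup T]
    {f g : Ind C (X →₀ MonoidAlgebra ℤ G) →+ T}
    (h : ∀ a x m, f (single C a (.single x (.single m 1))) =
      g (single C a (.single x (.single m 1)))) : f = g := by
  refine addHom_ext fun a y => ?_
  have : f.comp (single C a) = g.comp (single C a) := finsupp_addHom_ext fun x m => h a x m
  exact DFunLike.congr_fun this y

/-- The additive map on the module induced from a free module with prescribed values. -/
noncomputable def liftFreeAdd {T : Type*} [AddCommGroup T] (φ : A → X → G → T) :
    Ind C (X →₀ MonoidAlgebra ℤ G) →+ T :=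
  lift fun a => Finsupp.liftAddHom fun x => liftAdd (φ a x)

@[simp]
theorem liftFreeAdd_single {T : Type*} [AddCommGroup T] (φ : A → X → G → T) (a : A) (x : X)
    (g : G) : liftFreeAdd φ (single C a (.single x (.single g 1))) = φ a x g := by
  simp [liftFreeAdd]

/-- The linear map on the module induced from a free module with prescribed values. -/
noncomputable def liftFree {T : Type*} [AddCommGroup T]
    [Module (MonoidAlgebra ℤ (WithOne (ReesMatrix C))) T] (φ : A → X → G → T)
    (hφ : ∀ (s : ReesMatrix C) a x g,
      φ s.row x (s.val * C s.col a * g) =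
        MonoidAlgebra.single (s : WithOne (ReesMatrix C)) (1 : ℤ) • φ a x g) :
    Ind C (X →₀ MonoidAlgebra ℤ G) →ₗ[MonoidAlgebra ℤ (WithOne (ReesMatrix C))] T :=
  ReesMatrix.linearMapOfAddHom (liftFreeAdd φ) fun s x => by
    have : (liftFreeAdd φ).comp
        (DistribSMul.toAddMonoidHom (Ind C (X →₀ MonoidAlgebra ℤ G))
          (MonoidAlgebra.single (s : WithOne (ReesMatrix C)) (1 : ℤ))) =
        (DistribSMul.toAddMonoidHom T
          (MonoidAlgebra.single (s : WithOne (ReesMatrix C)) (1 : ℤ))).comp (liftFreeAdd φ) :=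
      free_addHom_ext fun a x g => by simp [coe_smul, ← hφ, mul_assoc]
    exact DFunLike.congr_fun this x

@[simp]
theorem liftFree_single {T : Type*} [AddCommGroup T]
    [Module (MonoidAlgebra ℤ (WithOne (ReesMatrix C))) T] (φ : A → X → G → T) (hφ)
    (a : A) (x : X) (g : G) :
    liftFree (C := C) φ hφ (single C a (.single x (.single g 1))) = φ a x g :=
  liftFreeAdd_single φ a x g

end Free

variable {a₀ : A} {b₀ : B} (hC : ReesMatrix.IsNormalized C a₀ b₀)
include hC

/-- The module is a direct sum of copies of ℤMe with e = (a₀, 1, b₀), hence a retract of a free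
module by right multiplication by e. -/
theorem projective_free (X : Type*) :
    Module.Projective (MonoidAlgebra ℤ (WithOne (ReesMatrix C)))
      (Ind C (X →₀ MonoidAlgebra ℤ G)) := by
  let i := liftFree (C := C)
    (T := X →₀ MonoidAlgebra ℤ (WithOne (ReesMatrix C)))
    (fun a x g => .single x (.single ((⟨a, g, b₀⟩ : ReesMatrix C) : WithOne (ReesMatrix C)) 1))
    (fun s a x g => by
      rw [Finsupp.smul_single, smul_eq_mul, single_mul_single, ← WithOne.coe_mul,
        ReesMatrix.mul_def, mul_one])
  let r : (X →₀ MonoidAlgebra ℤ (WithOne (ReesMatrix C))) →ₗ[_] _ :=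
    Finsupp.linearCombination (MonoidAlgebra ℤ (WithOne (ReesMatrix C)))
      fun x => single C a₀ (Finsupp.single x (1 : MonoidAlgebra ℤ G))
  refine Module.Projective.of_split i r ?_
  have : r.toAddMonoidHom.comp i.toAddMonoidHom = AddMonoidHom.id _ :=
    free_addHom_ext fun a x g => by
      simp [i, r, coe_smul, hC.2, one_def]
  exact LinearMap.ext fun x => DFunLike.congr_fun this x

theorem single_smul_eq (a : A) (g : G) (y : N) :
    single C a (MonoidAlgebra.single g (1 : ℤ) • y) =
      MonoidAlgebra.single ((⟨a, g, b₀⟩ : ReesMatrix C) : WithOne (ReesMatrix C)) (1 : ℤ) •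
        single C a₀ y := by
  rw [coe_smul, weightedSum_single, hC.2, single_one_smul_of_eq_one (M := G) rfl]

theorem finite [Module.Finite (MonoidAlgebra ℤ G) N] :
    Module.Finite (MonoidAlgebra ℤ (WithOne (ReesMatrix C))) (Ind C N) := by
  obtain ⟨t, ht⟩ := (inferInstance : Module.Finite (MonoidAlgebra ℤ G) N).fg_top
  classical
  let W := Submodule.span (MonoidAlgebra ℤ (WithOne (ReesMatrix C)))
    (t.image (single C a₀) : Set (Ind C N))
  have hsmul (r : MonoidAlgebra ℤ G) (y : N) (hy : single C a₀ y ∈ W) (a : A) :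
      single C a (r • y) ∈ W :=
    smul_mem_of_forall_single (H := W.toAddSubgroup.comap (single C a)) (fun g => by
      rw [AddSubgroup.mem_comap, single_smul_eq hC]
      exact W.smul_mem _ hy) r
  have hW (y : N) : ∀ a, single C a y ∈ W := by
    have hy : y ∈ Submodule.span (MonoidAlgebra ℤ G) (t : Set N) := ht ▸ Submodule.mem_top
    induction hy using Submodule.span_induction with
    | mem y hy =>
      intro a
      rw [← one_smul (MonoidAlgebra ℤ G) y]
      exact hsmul 1 y (Submodule.subset_span (by simpa using ⟨y, hy, rfl⟩)) a
    | zero => simp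
    | add y z _ _ hy hz => intro a; rw [map_add]; exact W.add_mem (hy a) (hz a)
    | smul r y _ hy => exact hsmul r y (hy a₀)
  refine ⟨⟨t.image (single C a₀), eq_top_iff.2 fun x _ => ?_⟩⟩
  exact mem_of_coord (H := W.toAddSubgroup) fun a => hW _ a

omit hC in
-- Finitely many generators have finitely many nonzero coordinates, even for infinite A. If these
-- span W, the elements with all coordinates in W form a stable subgroup containing the generators,
-- hence everything.
theorem finite_of_finite [Nonempty A]
    [Module.Finite (MonoidAlgebra ℤ (WithOne (ReesMatrix C))) (Ind C N)] :
    Module.Finite (MonoidAlgebra ℤ G) N := by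
  obtain ⟨t, ht⟩ := (inferInstance :
    Module.Finite (MonoidAlgebra ℤ (WithOne (ReesMatrix C))) (Ind C N)).fg_top
  let U : Set N := ⋃ x ∈ t, (fun a => coord a x) '' {a | coord a x ≠ 0}
  have hU : U.Finite := t.finite_toSet.biUnion fun x _ => (finite_coord_ne_zero x).image _
  let W := Submodule.span (MonoidAlgebra ℤ G) U
  let D : AddSubgroup (Ind C N) := ⨅ a, W.toAddSubgroup.comap (coord a)
  have hmem (x : Ind C N) : x ∈ D ↔ ∀ a, coord a x ∈ W := by
    simp only [D, AddSubgroup.mem_iInf]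
    rfl
  have hD (x : Ind C N) : x ∈ D := by
    refine ReesMatrix.span_subset_of_forall_coe (C := C) (t := t) (fun x hx => ?_)
      (fun s x hx => ?_) (ht ▸ Submodule.mem_top)
    · refine (hmem x).2 fun a => ?_
      by_cases h : coord a x = 0
      · rw [h]; exact W.zero_mem
      · exact Submodule.subset_span (Set.mem_biUnion hx ⟨a, h, rfl⟩)
    · refine (hmem _).2 fun a => ?_
      rw [coe_smul]
      by_cases h : a = s.row
      · subst h
        rw [coord_single_same]
        exact W.smul_mem _ (weightedSum_mem _ W ((hmem x).1 hx))
      · rw [coord_single_of_ne h]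
        exact W.zero_mem
  refine ⟨Submodule.fg_def.2 ⟨U, hU, eq_top_iff.2 fun y _ => ?_⟩⟩
  obtain ⟨a⟩ := ‹Nonempty A›
  have := (hmem _).1 (hD (single C a y)) a
  rwa [coord_single_same] at this

theorem finite_iff : Module.Finite (MonoidAlgebra ℤ (WithOne (ReesMatrix C))) (Ind C N) ↔
    Module.Finite (MonoidAlgebra ℤ G) N :=
  ⟨fun _ => have : Nonempty A := ⟨a₀⟩; finite_of_finite (C := C), fun _ => finite hC⟩

/-- Inducing a finite free cover of N lowers both finiteness types to the same kernel Z. Since Z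
lies in the universe of G whatever that of N, the induction on k can be run in that universe alone.
-/
theorem exists_moduleIsFP_succ_iff [Module.Finite (MonoidAlgebra ℤ G) N] :
    ∃ (m : ℕ) (Z : Submodule (MonoidAlgebra ℤ G) (Fin m →₀ MonoidAlgebra ℤ G)), ∀ k,
      (ModuleIsFP (MonoidAlgebra ℤ G) N (k + 1) ↔ ModuleIsFP (MonoidAlgebra ℤ G) Z k) ∧
      (ModuleIsFP (MonoidAlgebra ℤ (WithOne (ReesMatrix C))) (Ind C N) (k + 1) ↔
        ModuleIsFP (MonoidAlgebra ℤ (WithOne (ReesMatrix C))) (Ind C Z) k) := by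
  obtain ⟨m, f, hf⟩ := Module.Finite.exists_fin' (MonoidAlgebra ℤ G) N
  let e := Finsupp.linearEquivFunOnFinite (MonoidAlgebra ℤ G) (MonoidAlgebra ℤ G) (Fin m)
  let F := f ∘ₗ e.toLinearMap
  have hF : Function.Surjective F := hf.comp e.surjective
  have hex := F.exact_subtype_ker_map
  refine ⟨m, LinearMap.ker F, fun k => ⟨?_, ?_⟩⟩
  · exact moduleIsFP_succ_iff (LinearMap.ker F).injective_subtype hF hex
  · have := projective_free hC (Fin m)
    have := finite hC (N := Fin m →₀ MonoidAlgebra ℤ G)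
    exact moduleIsFP_succ_iff (map_injective (LinearMap.ker F).injective_subtype)
      (map_surjective hF) (map_exact hex)

theorem moduleIsFP_iff_of_universe {N : Type u} [AddCommGroup N] [Module (MonoidAlgebra ℤ G) N]
    (k : ℕ) : ModuleIsFP (MonoidAlgebra ℤ (WithOne (ReesMatrix C))) (Ind C N) k ↔
      ModuleIsFP (MonoidAlgebra ℤ G) N k := by
  induction k generalizing N with
  | zero => rw [moduleIsFP_zero_iff, moduleIsFP_zero_iff, finite_iff hC]
  | succ k ih =>
    by_cases h : Module.Finite (MonoidAlgebra ℤ G) N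
    · obtain ⟨m, Z, hZ⟩ := exists_moduleIsFP_succ_iff hC (N := N)
      rw [(hZ k).1, (hZ k).2, ih]
    · exact iff_of_false (fun h' => h ((finite_iff hC).1 h'.finite)) fun h' => h h'.finite

/-- A `ℤG`-module is of type `FP_k` if and only if its induced module is. -/
theorem moduleIsFP_iff (k : ℕ) :
    ModuleIsFP (MonoidAlgebra ℤ (WithOne (ReesMatrix C))) (Ind C N) k ↔
      ModuleIsFP (MonoidAlgebra ℤ G) N k := by
  cases k with
  | zero => rw [moduleIsFP_zero_iff, moduleIsFP_zero_iff, finite_iff hC]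
  | succ k =>
    by_cases h : Module.Finite (MonoidAlgebra ℤ G) N
    · obtain ⟨m, Z, hZ⟩ := exists_moduleIsFP_succ_iff hC (N := N)
      rw [(hZ k).1, (hZ k).2, moduleIsFP_iff_of_universe hC]
    · exact iff_of_false (fun h' => h ((finite_iff hC).1 h'.finite)) fun h' => h h'.finite

end Ind

end InducedModule

/-! ### The augmentation onto ℤ, and what finite generation of its kernel implies. -/

section TrivialModule

open MonoidAlgebra

variable {G : Type u} [Group G] {A : Type v} {B : Type w} {C : B → A → G}

theorem smul_trivial {M : Type*} [Monoid M] (m : M)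
    (k : (Representation.trivial ℤ M ℤ).asModule) : single m (1 : ℤ) • k = k :=
  (Representation.single_smul (Representation.trivial ℤ M ℤ) 1 m k).trans (one_smul ℤ _)

namespace Ind

omit [Group G] in
theorem regular_addHom_ext {T : Type*} [AddCommGroup T] {f g : Ind C (MonoidAlgebra ℤ G) →+ T}
    (h : ∀ a m, f (single C a (.single m 1)) = g (single C a (.single m 1))) : f = g := by
  refine addHom_ext fun a y => ?_
  have : f.comp (single C a) = g.comp (single C a) := int_addHom_ext fun m => h a m
  exact DFunLike.congr_fun this y

variable (C) in
/-- The sum of all coefficients. -/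
noncomputable def coeffSum : Ind C (MonoidAlgebra ℤ G) →+ ℤ :=
  lift fun _ => liftAdd fun _ => 1

omit [Group G] in
@[simp]
theorem coeffSum_single (a : A) (g : G) : coeffSum C (single C a (.single g 1)) = 1 := by
  simp [coeffSum]

theorem coeffSum_smul (s : ReesMatrix C) (x : Ind C (MonoidAlgebra ℤ G)) :
    coeffSum C (MonoidAlgebra.single (s : WithOne (ReesMatrix C)) (1 : ℤ) • x) = coeffSum C x := by
  have : (coeffSum C).comp (DistribSMul.toAddMonoidHom (Ind C (MonoidAlgebra ℤ G))
      (MonoidAlgebra.single (s : WithOne (ReesMatrix C)) (1 : ℤ))) = coeffSum C :=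
    regular_addHom_ext fun a g => by simp [coe_smul]
  exact DFunLike.congr_fun this x

variable (C) in
/-- The augmentation onto the trivial module. -/
noncomputable def aug : Ind C (MonoidAlgebra ℤ G) →ₗ[MonoidAlgebra ℤ (WithOne (ReesMatrix C))]
    (Representation.trivial ℤ (WithOne (ReesMatrix C)) ℤ).asModule :=
  ReesMatrix.linearMapOfAddHom (coeffSum C) fun s x =>
    (coeffSum_smul s x).trans (smul_trivial _ _).symm

theorem mem_ker_aug {x : Ind C (MonoidAlgebra ℤ G)} :
    x ∈ LinearMap.ker (aug C) ↔ coeffSum C x = 0 := Iff.rfl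

theorem aug_surjective [Nonempty A] : Function.Surjective (aug C) := by
  intro k
  obtain ⟨a⟩ := ‹Nonempty A›
  have h (k : ℤ) : coeffSum C (k • single C a (.single 1 1)) = k := by simp
  exact ⟨_, h k⟩

variable (C) in
/-- The componentwise augmentation. -/
noncomputable def augComp : Ind C (MonoidAlgebra ℤ G) →+ (A →₀ ℤ) :=
  lift fun a => liftAdd fun _ : G => Finsupp.single a 1

omit [Group G] in
@[simp]
theorem augComp_single (a : A) (g : G) :
    augComp C (single C a (.single g 1)) = Finsupp.single a 1 := by
  simp [augComp]

/-- An element of S pushes everything into a single component, so on the kernel of the augmentation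
its contribution vanishes. -/
theorem augComp_smul (s : ReesMatrix C) (x : Ind C (MonoidAlgebra ℤ G)) :
    augComp C (MonoidAlgebra.single (s : WithOne (ReesMatrix C)) (1 : ℤ) • x) =
      Finsupp.single s.row (coeffSum C x) := by
  have : (augComp C).comp (DistribSMul.toAddMonoidHom (Ind C (MonoidAlgebra ℤ G))
      (MonoidAlgebra.single (s : WithOne (ReesMatrix C)) (1 : ℤ))) =
      (Finsupp.singleAddHom s.row).comp (coeffSum C) :=
    regular_addHom_ext fun a g => by
      simp [coe_smul]
  exact DFunLike.congr_fun this x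

/-- The difference of the canonical generators of the components at `a` and `a₀`. -/
noncomputable def diff (a₀ a : A) : Ind C (MonoidAlgebra ℤ G) :=
  single C a (.single 1 1) - single C a₀ (.single 1 1)

theorem coeffSum_diff (a₀ a : A) : coeffSum C (diff a₀ a) = 0 := by
  simp [diff]

/-- On the kernel S contributes nothing to `augComp`, so its values there are supported on the
finite set U coming from the generators. The elements `diff a₀ a` then force every a ≠ a₀ into U. -/
theorem finite_of_ker_aug_fg (a₀ : A) (h : (LinearMap.ker (aug C)).FG) : Finite A := by
  obtain ⟨t, ht⟩ := h
  classical
  let U : Finset A := t.biUnion fun x => (augComp C x).support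
  let D : AddSubgroup (Ind C (MonoidAlgebra ℤ G)) :=
    (coeffSum C).ker ⊓
      ⨅ a : {a // a ∉ U}, ((Finsupp.applyAddHom a.1).comp (augComp C)).ker
  have hD (x : Ind C (MonoidAlgebra ℤ G)) :
      x ∈ D ↔ coeffSum C x = 0 ∧ ∀ a ∉ U, augComp C x a = 0 := by
    simp only [D, AddSubgroup.mem_inf, AddSubgroup.mem_iInf, Subtype.forall]
    rfl
  have hmem {x : Ind C (MonoidAlgebra ℤ G)} (hx : x ∈ LinearMap.ker (aug C)) : x ∈ D := by
    refine ReesMatrix.span_subset_of_forall_coe (C := C) (t := t) (fun y hy => ?_)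
      (fun s y hy => ?_) (ht ▸ hx)
    · refine (hD y).2 ⟨?_, fun a ha => ?_⟩
      · have : y ∈ LinearMap.ker (aug C) := ht ▸ Submodule.subset_span hy
        exact this
      · by_contra h
        exact ha (Finset.mem_biUnion.2 ⟨y, hy, Finsupp.mem_support_iff.2 h⟩)
    · rw [hD] at hy ⊢
      refine ⟨by rw [coeffSum_smul, hy.1], fun a _ => ?_⟩
      rw [augComp_smul, hy.1]
      exact DFunLike.congr_fun (Finsupp.single_zero s.row) a
  refine Set.finite_univ_iff.1 ((insert a₀ U).finite_toSet.subset fun a _ => ?_)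
  by_contra h
  simp only [Finset.coe_insert, Set.mem_insert_iff, Finset.mem_coe, not_or] at h
  have := ((hD _).1 (hmem (coeffSum_diff a₀ a))).2 a h.2
  rw [diff, map_sub, augComp_single, augComp_single] at this
  simp [h.1] at this

theorem exists_finite_surjective_of_ker_aug_fg {a₀ : A} {b₀ : B}
    (hC : ReesMatrix.IsNormalized C a₀ b₀) (h : (LinearMap.ker (aug C)).FG) :
    ∃ Y : Set G, Y.Finite ∧ Function.Surjective (ReesMatrix.naturalMap C a₀ Y) := by
  obtain ⟨t, ht⟩ := h
  let Y : Set G := ⋃ x ∈ t, ⋃ a ∈ {a | coord a x ≠ 0}, ((coord a x).coeff.support : Set G)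
  have hY : Y.Finite := t.finite_toSet.biUnion fun x _ => (finite_coord_ne_zero x).biUnion
    fun a _ => Finset.finite_toSet _
  refine ⟨Y, hY, ?_⟩
  let H := (ReesMatrix.naturalMap C a₀ Y).range
  have hYH (y : G) (hy : y ∈ Y) : y ∈ H := ⟨.of (.inl ⟨y, hy⟩), by simp [ReesMatrix.naturalMap]⟩
  have hCH (b : B) (a : A) : C b a ∈ H := by
    by_cases ha : a = a₀
    · rw [ha, hC.2]; exact H.one_mem
    · exact ⟨.of (.inr (⟨a, ha⟩, b)), by simp [ReesMatrix.naturalMap]⟩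
  -- Coefficients are summed over left cosets of H. Left multiplication by g permutes these cosets,
  -- so vanishing under q is preserved.
  let q : MonoidAlgebra ℤ G →+ (G ⧸ H →₀ ℤ) := liftAdd fun g => Finsupp.single (g : G ⧸ H) 1
  have hq (g : G) (y : MonoidAlgebra ℤ G) (hy : q y = 0) : q (.single g 1 * y) = 0 := by
    have : q.comp (AddMonoidHom.mulLeft (.single g 1)) =
        (Finsupp.mapDomain.addMonoidHom (g • · : G ⧸ H → G ⧸ H)).comp q :=
      int_addHom_ext fun m => by simp [q]
    rw [show q (.single g 1 * y) = _ from DFunLike.congr_fun this y, AddMonoidHom.comp_apply, hy,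
      map_zero]
  -- D is S-stable because the action is expressed through weighted sums. It contains the generators
  -- because their group elements lie in H by the choice of Y, and so do all entries of C.
  let D : AddSubgroup (Ind C (MonoidAlgebra ℤ G)) :=
    (coeffSum C).ker ⊓ ⨅ b, (q.comp (weightedSum b)).ker
  have hD (x : Ind C (MonoidAlgebra ℤ G)) :
      x ∈ D ↔ coeffSum C x = 0 ∧ ∀ b, q (weightedSum b x) = 0 := by
    simp only [D, AddSubgroup.mem_inf, AddSubgroup.mem_iInf]
    rfl
  have hsupp (x : Ind C (MonoidAlgebra ℤ G)) (hx : x ∈ t) (b : B) :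
      q (weightedSum b x) = coeffSum C x • Finsupp.single ((1 : G) : G ⧸ H) 1 := by
    let E : AddSubgroup (Ind C (MonoidAlgebra ℤ G)) := ((q.comp (weightedSum b)) -
      (AddMonoidHom.flip (smulAddHom ℤ (G ⧸ H →₀ ℤ))
        (Finsupp.single ((1 : G) : G ⧸ H) (1 : ℤ))).comp (coeffSum C)).ker
    have hE : x ∈ E := by
      refine mem_of_coord fun a => ?_
      rw [← sum_coeff_single (coord a x), Finsupp.sum, map_sum]
      refine AddSubgroup.sum_mem _ fun g hg => ?_
      have hgH : g ∈ H := hYH g <| Set.mem_biUnion hx <| Set.mem_biUnion (x := a)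
        (fun h0 => by simp [h0] at hg) hg
      have : (MonoidAlgebra.single g ((coord a x).coeff g) : MonoidAlgebra ℤ G) =
        (coord a x).coeff g • .single g 1 := by simp
      rw [this, map_zsmul]
      refine AddSubgroup.zsmul_mem _ ?_ _
      have hCg : ((C b a * g : G) : G ⧸ H) = (1 : G) :=
        (QuotientGroup.eq.2 (by simpa using H.mul_mem (hCH b a) hgH)).symm
      change q (weightedSum b (single C a (.single g 1))) -
        coeffSum C (single C a (.single g 1)) • Finsupp.single ((1 : G) : G ⧸ H) (1 : ℤ) = 0
      rw [coeffSum_single, weightedSum_single, smul_eq_mul, single_mul_single, sub_eq_zero]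
      simp [q, hCg]
    exact sub_eq_zero.1 hE
  have hmem {x : Ind C (MonoidAlgebra ℤ G)} (hx : x ∈ LinearMap.ker (aug C)) : x ∈ D := by
    refine ReesMatrix.span_subset_of_forall_coe (C := C) (t := t) (fun y hy => ?_)
      (fun s y hy => ?_) (ht ▸ hx)
    · have hy0 : coeffSum C y = 0 := by
        have : y ∈ LinearMap.ker (aug C) := ht ▸ Submodule.subset_span hy
        exact this
      refine (hD y).2 ⟨hy0, fun b => ?_⟩
      rw [hsupp y hy, hy0, zero_smul]
    · rw [hD] at hy ⊢
      refine ⟨by rw [coeffSum_smul, hy.1], fun b => ?_⟩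
      rw [coe_smul, weightedSum_single]
      exact hq _ _ (hq _ _ (hy.2 _))
  intro g
  -- Testing this element of the kernel against row b₀, where all entries are 1, gives gH = H.
  have hg : single C a₀ (.single g 1) - single C a₀ (.single 1 1) ∈ LinearMap.ker (aug C) := by
    rw [mem_ker_aug, map_sub, coeffSum_single, coeffSum_single, sub_self]
  have h0 := ((hD _).1 (hmem hg)).2 b₀
  rw [map_sub, weightedSum_single, weightedSum_single, hC.1] at h0
  simp only [smul_eq_mul, single_mul_single, one_mul, map_sub, q, liftAdd_single, one_smul,
    sub_eq_zero, Finsupp.single_left_inj one_ne_zero] at h0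
  have : g ∈ H := by simpa using QuotientGroup.eq.1 h0.symm
  exact this

end Ind

end TrivialModule

/-! ### A presentation of the augmentation kernel and its module of relations. -/

section PresentationOfKernel

open MonoidAlgebra

variable {G : Type u} [Group G] {A : Type v} {B : Type w} {C : B → A → G}

namespace Ind

section Presentation

variable (a₀ : A) (Y : Set G)

/-- The boundary map of the generators `Y`. -/
noncomputable def generatorBoundary :
    (Y →₀ MonoidAlgebra ℤ G) →ₗ[MonoidAlgebra ℤ G] MonoidAlgebra ℤ G :=
  Finsupp.linearCombination _ fun y => .single (y : G) 1 - 1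

theorem generatorBoundary_single (y : Y) (g : G) :
    generatorBoundary Y (.single y (.single g 1)) = .single (g * y) 1 - .single g 1 := by
  simp [generatorBoundary, mul_sub]

/-- The presentation of the kernel of the augmentation. -/
noncomputable def presentation :
    (({a : A // a ≠ a₀} →₀ MonoidAlgebra ℤ (WithOne (ReesMatrix C))) ×
      Ind C (Y →₀ MonoidAlgebra ℤ G)) →ₗ[MonoidAlgebra ℤ (WithOne (ReesMatrix C))]
      Ind C (MonoidAlgebra ℤ G) :=
  (Finsupp.linearCombination _ fun a => diff a₀ a.1).coprod (map C (generatorBoundary Y))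

/-- The module induced from `ℤG^(X)`, as a submodule of the source of the presentation. -/
noncomputable def toPresentation :
    Ind C ((Y ⊕ ({a : A // a ≠ a₀} × B)) →₀ MonoidAlgebra ℤ G)
      →ₗ[MonoidAlgebra ℤ (WithOne (ReesMatrix C))]
    (({a : A // a ≠ a₀} →₀ MonoidAlgebra ℤ (WithOne (ReesMatrix C))) ×
      Ind C (Y →₀ MonoidAlgebra ℤ G)) :=
  liftFree (fun a x g => Sum.elim
      (fun y => (0, single C a (.single y (.single g 1))))
      (fun p => (.single p.1 (.single ((⟨a, g, p.2⟩ : ReesMatrix C) : WithOne (ReesMatrix C)) 1), 0))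
      x)
    (fun s a x g => by
      rcases x with y | p
      · simp [coe_smul, mul_assoc]
      · simp [← WithOne.coe_mul, ReesMatrix.mul_def])

/-- The retraction of the source of the presentation onto the module induced from `ℤG^(X)`. -/
noncomputable def ofPresentation :
    (({a : A // a ≠ a₀} →₀ MonoidAlgebra ℤ (WithOne (ReesMatrix C))) ×
      Ind C (Y →₀ MonoidAlgebra ℤ G)) →+
    Ind C ((Y ⊕ ({a : A // a ≠ a₀} × B)) →₀ MonoidAlgebra ℤ G) :=
  (Finsupp.liftAddHom fun a => liftAdd fun m : WithOne (ReesMatrix C) =>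
      WithOne.recOneCoe 0
        (fun s => single C s.row (.single (.inr (a, s.col)) (.single s.val 1))) m).coprod
    (liftFreeAdd fun a y g => single C a (.single (.inl y) (.single g 1)))

/-- The coefficients of the identity of the monoid. -/
noncomputable def unitCoeff :
    (({a : A // a ≠ a₀} →₀ MonoidAlgebra ℤ (WithOne (ReesMatrix C))) ×
      Ind C (Y →₀ MonoidAlgebra ℤ G)) →+ ({a : A // a ≠ a₀} →₀ ℤ) :=
  (Finsupp.liftAddHom fun a => liftAdd fun m : WithOne (ReesMatrix C) =>
      WithOne.recOneCoe (.single a 1) (fun _ => 0) m).coprod 0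

/-- Applying (a, g, b) to the difference for a' gives g C_{ba'} - g C_{ba₀} in component a. As
C_{ba₀} = 1, this is the Fox boundary of the formal symbol C_{ba'} translated by g: hence one
generator for each pair. -/
theorem presentation_toPresentation {b₀ : B} (hC : ReesMatrix.IsNormalized C a₀ b₀)
    (z : Ind C ((Y ⊕ ({a : A // a ≠ a₀} × B)) →₀ MonoidAlgebra ℤ G)) :
    presentation a₀ Y (toPresentation (C := C) a₀ Y z) =
      map C (foxBoundary (ReesMatrix.naturalMap C a₀ Y)) z := by
  have : (presentation a₀ Y ∘ₗ toPresentation (C := C) a₀ Y).toAddMonoidHom =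
      (map C (foxBoundary (ReesMatrix.naturalMap C a₀ Y))).toAddMonoidHom :=
    free_addHom_ext fun a x g => by
      rcases x with y | p
      · simp [toPresentation, presentation, generatorBoundary_single, foxBoundary_single,
          ReesMatrix.naturalMap]
      · simp [toPresentation, presentation, foxBoundary_single, ReesMatrix.naturalMap, diff,
          smul_sub, coe_smul, hC.2]
  exact DFunLike.congr_fun this z

theorem ofPresentation_toPresentation
    (z : Ind C ((Y ⊕ ({a : A // a ≠ a₀} × B)) →₀ MonoidAlgebra ℤ G)) :
    ofPresentation a₀ Y (toPresentation (C := C) a₀ Y z) = z := by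
  have : (ofPresentation a₀ Y).comp (toPresentation (C := C) a₀ Y).toAddMonoidHom =
      AddMonoidHom.id _ :=
    free_addHom_ext fun a x g => by
      rcases x with y | p <;> simp [toPresentation, ofPresentation]
  exact DFunLike.congr_fun this z

theorem prod_addHom_ext {T : Type*} [AddCommGroup T]
    {f g : (({a : A // a ≠ a₀} →₀ MonoidAlgebra ℤ (WithOne (ReesMatrix C))) ×
      Ind C (Y →₀ MonoidAlgebra ℤ G)) →+ T}
    (h1 : ∀ a, f (.single a (.single 1 1), 0) = g (.single a (.single 1 1), 0))
    (hs : ∀ a (s : ReesMatrix C),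
      f (.single a (.single (s : WithOne (ReesMatrix C)) 1), 0) =
        g (.single a (.single (s : WithOne (ReesMatrix C)) 1), 0))
    (hY : ∀ a y m, f (0, single C a (.single y (.single m 1))) =
      g (0, single C a (.single y (.single m 1)))) : f = g := by
  have h2 : f.comp (AddMonoidHom.inl _ _) = g.comp (AddMonoidHom.inl _ _) :=
    finsupp_addHom_ext fun a m => by
      induction m using WithOne.recOneCoe with
      | one => exact h1 a
      | coe s => exact hs a s
  have h3 : f.comp (AddMonoidHom.inr _ _) = g.comp (AddMonoidHom.inr _ _) :=
    free_addHom_ext hY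
  rw [← AddMonoidHom.coprod_unique f, h2, h3, AddMonoidHom.coprod_unique]

theorem toPresentation_ofPresentation
    {p : (({a : A // a ≠ a₀} →₀ MonoidAlgebra ℤ (WithOne (ReesMatrix C))) ×
      Ind C (Y →₀ MonoidAlgebra ℤ G))} (hp : unitCoeff a₀ Y p = 0) :
    toPresentation a₀ Y (ofPresentation a₀ Y p) = p := by
  let e : ({a : A // a ≠ a₀} →₀ ℤ) →+
      (({a : A // a ≠ a₀} →₀ MonoidAlgebra ℤ (WithOne (ReesMatrix C))) ×
        Ind C (Y →₀ MonoidAlgebra ℤ G)) :=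
    (AddMonoidHom.inl _ _).comp (Finsupp.liftAddHom fun a =>
      (Finsupp.singleAddHom a).comp (singleAddHom 1))
  have : (toPresentation (C := C) a₀ Y).toAddMonoidHom.comp (ofPresentation a₀ Y) +
      e.comp (unitCoeff a₀ Y) = AddMonoidHom.id _ := by
    refine prod_addHom_ext a₀ Y (fun a => ?_) (fun a s => ?_) fun a y m => ?_
    all_goals simp [toPresentation, ofPresentation, unitCoeff, e]
  have := DFunLike.congr_fun this p
  simpa [hp] using this

/-- Only the identity of M is visible here: S kills the componentwise augmentation of a difference,
and the boundaries of the elements of Y have augmentation 0. So no relation involves the identity.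
-/
theorem augComp_presentation (a : {a : A // a ≠ a₀})
    (p : (({a : A // a ≠ a₀} →₀ MonoidAlgebra ℤ (WithOne (ReesMatrix C))) ×
      Ind C (Y →₀ MonoidAlgebra ℤ G))) :
    augComp C (presentation a₀ Y p) a = unitCoeff a₀ Y p a := by
  have : ((Finsupp.applyAddHom a.1).comp (augComp C)).comp (presentation a₀ Y).toAddMonoidHom =
      (Finsupp.applyAddHom a).comp (unitCoeff a₀ Y) := by
    refine prod_addHom_ext a₀ Y (fun a' => ?_) (fun a s => ?_) fun a y m => ?_
    · simp only [AddMonoidHom.comp_apply, LinearMap.toAddMonoidHom_coe, presentation, unitCoeff,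
        LinearMap.coprod_apply, map_zero, add_zero, Finsupp.linearCombination_single, ← one_def,
        one_smul, diff, map_sub, Finsupp.applyAddHom_apply, AddMonoidHom.coprod_apply,
        Finsupp.liftAddHom_apply_single]
      rw [one_def, one_def, augComp_single, augComp_single, liftAdd_single, one_smul]
      rcases eq_or_ne a a' with rfl | h
      · simp [a.2.symm]
      · simp [a.2.symm, h, Subtype.coe_injective.ne h]
    · simp [presentation, unitCoeff, augComp_smul, coeffSum_diff]
    · simp [presentation, unitCoeff, generatorBoundary_single]
  exact DFunLike.congr_fun this p

variable {a₀ Y} in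
theorem range_presentation {b₀ : B} (hC : ReesMatrix.IsNormalized C a₀ b₀)
    (hY : Function.Surjective (ReesMatrix.naturalMap C a₀ Y)) :
    LinearMap.range (presentation (C := C) a₀ Y) = LinearMap.ker (aug C) := by
  apply le_antisymm
  · rintro _ ⟨p, rfl⟩
    have : (coeffSum C).comp (presentation a₀ Y).toAddMonoidHom = 0 := by
      refine prod_addHom_ext a₀ Y (fun a' => ?_) (fun a s => ?_) fun a y m => ?_
      · simp [presentation, coeffSum_diff, ← one_def]
      · simp [presentation, coeffSum_smul, coeffSum_diff]
      · simp [presentation, generatorBoundary_single]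
    exact mem_ker_aug.2 (DFunLike.congr_fun this p)
  -- These differences span the kernel. Inside one component they come from the Fox derivative of a
  -- word for g; between components, from the free generators.
  · have hgen (a : A) (g : G) : single C a (.single g 1) - single C a₀ (.single 1 1) ∈
        LinearMap.range (presentation (C := C) a₀ Y) := by
      have h1 : single C a (.single g 1) - single C a (.single 1 1) ∈
          LinearMap.range (presentation (C := C) a₀ Y) := by
        obtain ⟨w, rfl⟩ := hY g
        refine ⟨toPresentation a₀ Y (single C a (foxDerivative (ReesMatrix.naturalMap C a₀ Y) w)), ?_⟩
        rw [presentation_toPresentation a₀ Y hC, map_single, foxBoundary_foxDerivative, map_sub,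
          one_def]
      have h2 : diff a₀ a ∈ LinearMap.range (presentation (C := C) a₀ Y) := by
        by_cases ha : a = a₀
        · rw [ha, diff, sub_self]
          exact Submodule.zero_mem _
        · exact ⟨(.single ⟨a, ha⟩ 1, 0), by simp [presentation]⟩
      have := Submodule.add_mem _ h1 h2
      rwa [diff, sub_add_sub_cancel] at this
    have hall : (LinearMap.range (presentation (C := C) a₀ Y)).mkQ.toAddMonoidHom.comp
        (AddMonoidHom.id _ - (AddMonoidHom.flip (smulAddHom ℤ (Ind C (MonoidAlgebra ℤ G)))
          (single C a₀ (.single 1 1))).comp (coeffSum C)) = 0 :=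
      regular_addHom_ext fun a g => by
        have := (Submodule.Quotient.mk_eq_zero _).2 (hgen a g)
        simpa using this
    intro x hx
    have := DFunLike.congr_fun hall x
    simpa [mem_ker_aug.1 hx] using this

section Kernel

variable {N N' : Type*} [AddCommGroup N] [Module (MonoidAlgebra ℤ G) N]
    [AddCommGroup N'] [Module (MonoidAlgebra ℤ G) N'] (f : N →ₗ[MonoidAlgebra ℤ G] N')

variable (C) in
/-- The map induced by the inclusion of a kernel. -/
noncomputable def mapKer :
    Ind C (LinearMap.ker f) →ₗ[MonoidAlgebra ℤ (WithOne (ReesMatrix C))] Ind C N :=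
  map C (LinearMap.ker f).subtype

theorem mapKer_injective : Function.Injective (mapKer C f) :=
  map_injective (LinearMap.ker f).injective_subtype

theorem mapKer_exact : Function.Exact (mapKer C f) (map C f) :=
  map_exact f.exact_subtype_ker_map

theorem moduleIsFP_ker_iff {b₀ : B} (hC : ReesMatrix.IsNormalized C a₀ b₀) (n : ℕ) :
    ModuleIsFP (MonoidAlgebra ℤ (WithOne (ReesMatrix C))) (Ind C (LinearMap.ker f)) n ↔
      ModuleIsFP (MonoidAlgebra ℤ G) (LinearMap.ker f) n :=
  moduleIsFP_iff hC n

end Kernel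

variable {a₀ Y} in
theorem exact_presentation {b₀ : B} (hC : ReesMatrix.IsNormalized C a₀ b₀) :
    Function.Exact (toPresentation (C := C) a₀ Y ∘ₗ mapKer C
        (foxBoundary (ReesMatrix.naturalMap C a₀ Y)))
      (presentation (C := C) a₀ Y) := by
  have hex := mapKer_exact (C := C) (foxBoundary (ReesMatrix.naturalMap C a₀ Y))
  intro p
  constructor
  · intro hp
    have hu : unitCoeff a₀ Y p = 0 := Finsupp.ext fun a => by
      rw [← augComp_presentation, hp, map_zero]
      rfl
    have hp' := toPresentation_ofPresentation a₀ Y hu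
    obtain ⟨z, hz⟩ := (hex (ofPresentation a₀ Y p)).1 (by
      rw [← presentation_toPresentation a₀ Y hC, hp', hp])
    exact ⟨z, by rw [LinearMap.comp_apply, hz, hp']⟩
  · rintro ⟨z, rfl⟩
    rw [LinearMap.comp_apply, presentation_toPresentation a₀ Y hC]
    exact (hex _).2 ⟨z, rfl⟩

variable {a₀ Y} in
-- Finiteness of A and Y makes the source of the presentation finitely generated projective, so one
-- dimension shift suffices. The set B may be infinite: it enters only through the relations.
theorem moduleIsFP_ker_aug_succ_iff [Finite A] (hfin : Y.Finite) {b₀ : B}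
    (hC : ReesMatrix.IsNormalized C a₀ b₀)
    (hY : Function.Surjective (ReesMatrix.naturalMap C a₀ Y)) (n : ℕ) :
    ModuleIsFP (MonoidAlgebra ℤ (WithOne (ReesMatrix C))) (LinearMap.ker (aug C)) (n + 1) ↔
      RelationModuleIsFP (ReesMatrix.naturalMap C a₀ Y) hY n := by
  have := hfin.to_subtype
  have := projective_free hC Y
  have := finite hC (N := Y →₀ MonoidAlgebra ℤ G)
  rw [relationModuleIsFP_iff, ← moduleIsFP_ker_iff a₀ _ hC]
  let f := (presentation (C := C) a₀ Y).codRestrict (LinearMap.ker (aug C)) fun p =>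
    range_presentation hC hY ▸ ⟨p, rfl⟩
  refine moduleIsFP_succ_iff (f := f) (i := toPresentation (C := C) a₀ Y ∘ₗ mapKer C
        (foxBoundary (ReesMatrix.naturalMap C a₀ Y))) ?_ ?_ ?_
  · exact (Function.LeftInverse.injective (g := ofPresentation a₀ Y)
      (ofPresentation_toPresentation a₀ Y)).comp (mapKer_injective _)
  · rintro ⟨x, hx⟩
    rw [← range_presentation hC hY] at hx
    obtain ⟨p, rfl⟩ := hx
    exact ⟨p, rfl⟩
  · intro p
    rw [← exact_presentation hC p, Subtype.ext_iff]
    rfl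

variable {a₀ Y} in
theorem finite_ker_aug [Finite A] (hfin : Y.Finite) {b₀ : B}
    (hC : ReesMatrix.IsNormalized C a₀ b₀)
    (hY : Function.Surjective (ReesMatrix.naturalMap C a₀ Y)) :
    (LinearMap.ker (aug C)).FG := by
  have := hfin.to_subtype
  have := finite hC (N := Y →₀ MonoidAlgebra ℤ G)
  rw [← range_presentation hC hY, LinearMap.range_eq_map]
  exact Module.Finite.fg_top.map _

end Presentation

end Ind

end PresentationOfKernel

/-! ### Schanuel-type comparison of kernels. -/

section Schanuel

open LinearMap

variable {R : Type u} [Ring R]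

/-- Adding P both to N and to a finite free cover of N leaves the kernel unchanged. -/
theorem moduleIsFP_prod_iff {N : Type v} {P : Type w} [AddCommGroup N] [Module R N]
    [AddCommGroup P] [Module R P] [Module.Finite R P] [Module.Projective R P] (n : ℕ) :
    ModuleIsFP R (N × P) n ↔ ModuleIsFP R N n := by
  have hfin : Module.Finite R (N × P) ↔ Module.Finite R N :=
    ⟨fun _ => .of_surjective (LinearMap.fst R N P) LinearMap.fst_surjective,
      fun _ => inferInstance⟩
  cases n with
  | zero => rw [moduleIsFP_zero_iff, moduleIsFP_zero_iff, hfin]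
  | succ n =>
    by_cases h : Module.Finite R N
    · obtain ⟨m, f, hf⟩ := Module.Finite.exists_fin' R N
      rw [moduleIsFP_succ_iff (ker f).injective_subtype hf f.exact_subtype_ker_map]
      refine moduleIsFP_succ_iff (i := LinearMap.inl R (Fin m → R) P ∘ₗ (ker f).subtype)
        (f := f.prodMap LinearMap.id) (LinearMap.inl_injective.comp (ker f).injective_subtype)
        (Prod.map_surjective.2 ⟨hf, Function.surjective_id⟩) fun x => ?_
      constructor
      · intro hx
        obtain ⟨h1, h2⟩ := Prod.ext_iff.1 hx
        exact ⟨⟨x.1, h1⟩, Prod.ext rfl h2.symm⟩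
      · rintro ⟨z, rfl⟩
        exact Prod.ext z.2 rfl
    · exact iff_of_false (fun h' => h (hfin.1 h'.finite)) fun h' => h h'.finite

theorem moduleIsFP_ker_congr {M : Type v} {M' : Type w} {I : Type x} [AddCommGroup M] [Module R M]
    [AddCommGroup M'] [Module R M'] [AddCommGroup I] [Module R I] (e : M ≃ₗ[R] M')
    {f : M →ₗ[R] I} {f' : M' →ₗ[R] I} (h : ∀ x, f' (e x) = f x) (n : ℕ) :
    ModuleIsFP R (ker f) n ↔ ModuleIsFP R (ker f') n := by
  refine moduleIsFP_congr (e.ofSubmodules (ker f) (ker f') ?_) n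
  ext y
  obtain ⟨x, rfl⟩ := e.surjective y
  simp [h]

/-- Projectivity lifts p through f to some σ, and the shear (y, x) ↦ (y - σ x, x) splits P off the
kernel. -/
theorem moduleIsFP_ker_coprod_iff {U P I : Type*} [AddCommGroup U] [Module R U]
    [AddCommGroup P] [Module R P] [AddCommGroup I] [Module R I] [Module.Finite R P]
    [Module.Projective R P] {f : U →ₗ[R] I} {p : P →ₗ[R] I} (h : range p ≤ range f) (n : ℕ) :
    ModuleIsFP R (ker (f.coprod p)) n ↔ ModuleIsFP R (ker f) n := by
  obtain ⟨σ, hσ⟩ := Module.projective_lifting_property f.rangeRestrict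
    (p.codRestrict (range f) fun x => h ⟨x, rfl⟩) f.surjective_rangeRestrict
  have hσ' (x : P) : f (σ x) = p x := congrArg Subtype.val (LinearMap.congr_fun hσ x)
  rw [← moduleIsFP_prod_iff (N := ker f) (P := P)]
  let s : (ker f × P) →ₗ[R] ker (f.coprod p) :=
    (((ker f).subtype ∘ₗ LinearMap.fst R _ _ - σ ∘ₗ LinearMap.snd R (ker f) P).prod
      (LinearMap.snd R _ _)).codRestrict (ker (f.coprod p)) fun x => by simp [hσ']
  refine (moduleIsFP_congr (LinearEquiv.ofBijective s ⟨?_, ?_⟩) n).symm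
  · rintro ⟨z, x⟩ ⟨z', x'⟩ h
    have h := Prod.ext_iff.1 (Subtype.ext_iff.1 h)
    obtain rfl : x = x' := h.2
    exact Prod.ext (Subtype.ext (sub_left_injective (b := σ x) h.1)) rfl
  · rintro ⟨⟨y, x⟩, h⟩
    have h : f y + p x = 0 := by simpa using h
    refine ⟨(⟨y + σ x, by simp [hσ', h]⟩, x), Subtype.ext (Prod.ext ?_ rfl)⟩
    exact add_sub_cancel_right y (σ x)

/-- Both kernels are compared with that of the combined map on P × T × P'. The common summand T
needs no finiteness. -/
theorem moduleIsFP_ker_coprod_congr {P P' T I : Type*} [AddCommGroup P] [Module R P]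
    [AddCommGroup P'] [Module R P'] [AddCommGroup T] [Module R T] [AddCommGroup I] [Module R I]
    [Module.Finite R P] [Module.Projective R P] [Module.Finite R P'] [Module.Projective R P']
    {p : P →ₗ[R] I} {p' : P' →ₗ[R] I} {c : T →ₗ[R] I} (h : range p ≤ range (p'.coprod c))
    (h' : range p' ≤ range (p.coprod c)) (n : ℕ) :
    ModuleIsFP R (ker (p.coprod c)) n ↔ ModuleIsFP R (ker (p'.coprod c)) n := by
  rw [← moduleIsFP_ker_coprod_iff h, ← moduleIsFP_ker_coprod_iff h']
  let e : ((P × T) × P') ≃ₗ[R] ((P' × T) × P) :=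
    (LinearEquiv.prodComm R _ _).trans ((LinearEquiv.prodCongr (LinearEquiv.refl R P')
      (LinearEquiv.prodComm R P T)).trans (LinearEquiv.prodAssoc R P' T P).symm)
  refine moduleIsFP_ker_congr e (fun x => ?_) n
  change p' x.2 + c x.1.2 + p x.1.1 = p x.1.1 + c x.1.2 + p' x.2
  abel

theorem moduleIsFP_ker_congr_of_coprod {P P' T I U U' : Type*} [AddCommGroup P] [Module R P]
    [AddCommGroup P'] [Module R P'] [AddCommGroup T] [Module R T] [AddCommGroup I] [Module R I]
    [AddCommGroup U] [Module R U] [AddCommGroup U'] [Module R U']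
    [Module.Finite R P] [Module.Projective R P] [Module.Finite R P'] [Module.Projective R P']
    {p : P →ₗ[R] I} {p' : P' →ₗ[R] I} {c : T →ₗ[R] I} (h : range p ≤ range (p'.coprod c))
    (h' : range p' ≤ range (p.coprod c)) {f : U →ₗ[R] I} {f' : U' →ₗ[R] I} (e : U ≃ₗ[R] P × T)
    (he : ∀ z, p.coprod c (e z) = f z) (e' : U' ≃ₗ[R] P' × T)
    (he' : ∀ z, p'.coprod c (e' z) = f' z) (n : ℕ) :
    ModuleIsFP R (ker f) n ↔ ModuleIsFP R (ker f') n := by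
  rw [moduleIsFP_ker_congr e he, moduleIsFP_ker_congr e' he']
  exact moduleIsFP_ker_coprod_congr h h' n

end Schanuel

/-! ### Assembling the theorem. -/

section FinitenessTheorem

open MonoidAlgebra

variable {G : Type u} [Group G] {A : Type v} {B : Type w} {C : B → A → G} {a₀ : A} {b₀ : B}

theorem monoidIsFP_succ_iff (hC : ReesMatrix.IsNormalized C a₀ b₀) (n : ℕ) :
    MonoidIsFP (WithOne (ReesMatrix C)) (n + 1) ↔
      ModuleIsFP (MonoidAlgebra ℤ (WithOne (ReesMatrix C))) (LinearMap.ker (Ind.aug C)) n := by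
  have : Nonempty A := ⟨a₀⟩
  have := Ind.finite hC (N := MonoidAlgebra ℤ G)
  have hproj := Ind.projective_free hC Unit
  let e := Finsupp.uniqueLinearEquiv (MonoidAlgebra ℤ G) (MonoidAlgebra ℤ G) ()
  have : Module.Projective (MonoidAlgebra ℤ (WithOne (ReesMatrix C))) (Ind C (MonoidAlgebra ℤ G)) :=
    .of_equiv (LinearEquiv.ofBijective (Ind.map C e.toLinearMap)
      ⟨Ind.map_injective e.injective, Ind.map_surjective e.surjective⟩)
  exact moduleIsFP_succ_iff (LinearMap.ker (Ind.aug C)).injective_subtype Ind.aug_surjective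
    (LinearMap.exact_subtype_ker_map _)

/-- The boundary map of the generators given by the matrix entries. -/
noncomputable def entryBoundary (C : B → A → G) (a₀ : A) :
    (({a : A // a ≠ a₀} × B) →₀ MonoidAlgebra ℤ G) →ₗ[MonoidAlgebra ℤ G] MonoidAlgebra ℤ G :=
  Finsupp.linearCombination _ fun p => .single (C p.2 p.1) 1 - 1

theorem coprod_sumFinsuppLEquivProdFinsupp (Y : Set G)
    (z : (Y ⊕ ({a : A // a ≠ a₀} × B)) →₀ MonoidAlgebra ℤ G) :
    (Ind.generatorBoundary Y).coprod (entryBoundary C a₀)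
      (Finsupp.sumFinsuppLEquivProdFinsupp (MonoidAlgebra ℤ G) z) =
        foxBoundary (ReesMatrix.naturalMap C a₀ Y) z := by
  have : ((Ind.generatorBoundary Y).coprod (entryBoundary C a₀)) ∘ₗ
      (Finsupp.sumFinsuppLEquivProdFinsupp (MonoidAlgebra ℤ G)).toLinearMap =
        foxBoundary (ReesMatrix.naturalMap C a₀ Y) := by
    refine Finsupp.lhom_ext' fun x => LinearMap.ext_ring ?_
    have hl (y : Y) : Finsupp.sumFinsuppLEquivProdFinsupp (MonoidAlgebra ℤ G)
        (Finsupp.single (Sum.inl y) (1 : MonoidAlgebra ℤ G)) =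
          (.single y 1, (0 : ({a : A // a ≠ a₀} × B) →₀ MonoidAlgebra ℤ G)) :=
      Prod.ext (Finsupp.ext fun y' => by
        rw [Finsupp.fst_sumFinsuppLEquivProdFinsupp]
        exact Finsupp.single_apply_left Sum.inl_injective y y' 1) (Finsupp.ext fun y' => by
        rw [Finsupp.snd_sumFinsuppLEquivProdFinsupp]
        simp)
    have hr (q : {a : A // a ≠ a₀} × B) : Finsupp.sumFinsuppLEquivProdFinsupp (MonoidAlgebra ℤ G)
        (Finsupp.single (Sum.inr q) (1 : MonoidAlgebra ℤ G)) =
          ((0 : Y →₀ MonoidAlgebra ℤ G), .single q 1) :=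
      Prod.ext (Finsupp.ext fun y' => by
        rw [Finsupp.fst_sumFinsuppLEquivProdFinsupp]
        simp) (Finsupp.ext fun y' => by
        rw [Finsupp.snd_sumFinsuppLEquivProdFinsupp]
        exact Finsupp.single_apply_left Sum.inr_injective q y' 1)
    rcases x with y | q
    · simp [hl, foxBoundary, Ind.generatorBoundary, ReesMatrix.naturalMap]
    · simp [hr, foxBoundary, entryBoundary, ReesMatrix.naturalMap]
  exact LinearMap.congr_fun this z

theorem range_generatorBoundary_le {Y Y' : Set G}
    (hY : Function.Surjective (ReesMatrix.naturalMap C a₀ Y)) :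
    LinearMap.range (Ind.generatorBoundary Y') ≤
      LinearMap.range ((Ind.generatorBoundary Y).coprod (entryBoundary C a₀)) := by
  rw [Ind.generatorBoundary, Finsupp.range_linearCombination, Submodule.span_le]
  rintro _ ⟨y, rfl⟩
  obtain ⟨w, hw⟩ := hY y
  refine ⟨Finsupp.sumFinsuppLEquivProdFinsupp (MonoidAlgebra ℤ G) 
    (foxDerivative (ReesMatrix.naturalMap C a₀ Y) w), ?_⟩
  rw [coprod_sumFinsuppLEquivProdFinsupp, foxBoundary_foxDerivative, hw]

/-- Here T is the free module on the matrix symbols. Neither A nor B is assumed finite, so the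
comparison is made over ℤG and not through M. -/
theorem relationModuleIsFP_congr {Y Y' : Set G} (hfin : Y.Finite) (hfin' : Y'.Finite)
    (hY : Function.Surjective (ReesMatrix.naturalMap C a₀ Y))
    (hY' : Function.Surjective (ReesMatrix.naturalMap C a₀ Y')) (n : ℕ) :
    RelationModuleIsFP (ReesMatrix.naturalMap C a₀ Y) hY n ↔
      RelationModuleIsFP (ReesMatrix.naturalMap C a₀ Y') hY' n := by
  have := hfin.to_subtype
  have := hfin'.to_subtype
  rw [relationModuleIsFP_iff, relationModuleIsFP_iff]
  exact moduleIsFP_ker_congr_of_coprod (P := Y →₀ MonoidAlgebra ℤ G)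
    (P' := Y' →₀ MonoidAlgebra ℤ G) (T := ({a : A // a ≠ a₀} × B) →₀ MonoidAlgebra ℤ G)
    (range_generatorBoundary_le hY') (range_generatorBoundary_le hY)
    (Finsupp.sumFinsuppLEquivProdFinsupp (MonoidAlgebra ℤ G))
    (coprod_sumFinsuppLEquivProdFinsupp Y)
    (Finsupp.sumFinsuppLEquivProdFinsupp (MonoidAlgebra ℤ G))
    (coprod_sumFinsuppLEquivProdFinsupp Y') n

end FinitenessTheorem

theorem theoremt {G : Type u} [Group G] {A : Type v} {B : Type w} (C : B → A → G)
    (a₀ : A) (b₀ : B) (hC : ReesMatrix.IsNormalized C a₀ b₀) (n : ℕ) (hn : 1 ≤ n) :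
    (MonoidIsFP (WithOne (ReesMatrix C)) n ↔
      Finite A ∧ ∃ Y : Set G, Y.Finite ∧
        ∃ hY : Function.Surjective (ReesMatrix.naturalMap C a₀ Y),
          2 ≤ n → RelationModuleIsFP (ReesMatrix.naturalMap C a₀ Y) hY (n - 2)) ∧
    (∀ Y Y' : Set G, Y.Finite → Y'.Finite →
      ∀ (hY : Function.Surjective (ReesMatrix.naturalMap C a₀ Y))
        (hY' : Function.Surjective (ReesMatrix.naturalMap C a₀ Y')),
        2 ≤ n → (RelationModuleIsFP (ReesMatrix.naturalMap C a₀ Y) hY (n - 2) ↔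
          RelationModuleIsFP (ReesMatrix.naturalMap C a₀ Y') hY' (n - 2))) := by
  refine ⟨?_, fun Y Y' hfin hfin' hY hY' _ => relationModuleIsFP_congr hfin hfin' hY hY' _⟩
  obtain ⟨n, rfl⟩ := Nat.exists_eq_add_of_le' hn
  rw [monoidIsFP_succ_iff hC]
  constructor
  · intro h
    have hfg : (LinearMap.ker (Ind.aug C)).FG := Module.Finite.iff_fg.1 h.finite
    have := Ind.finite_of_ker_aug_fg a₀ hfg
    obtain ⟨Y, hfin, hY⟩ := Ind.exists_finite_surjective_of_ker_aug_fg hC hfg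
    refine ⟨this, Y, hfin, hY, fun hn2 => ?_⟩
    -- The original index is now k + 2, so the truncated subtraction gives exactly k.
    obtain ⟨k, rfl⟩ := Nat.exists_eq_add_of_le' (Nat.le_of_succ_le_succ hn2)
    exact (Ind.moduleIsFP_ker_aug_succ_iff hfin hC hY k).1 h
  · rintro ⟨_, Y, hfin, hY, h⟩
    cases n with
    | zero => exact moduleIsFP_zero_iff.2 (Module.Finite.iff_fg.2 (Ind.finite_ker_aug hfin hC hY))
    | succ k => exact (Ind.moduleIsFP_ker_aug_succ_iff hfin hC hY k).2 (h (by omega))
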